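/- Let $n\ge 3$ and $m>0$. Place unit masses at the vertices $q_k=(\cos\frac{2\pi k}{n},\sin\frac{2\pi k}{n})$, $1\le k\le n$, of a regular $n$-gon in $\mathbb{R}^2$ and a mass $m$ at its center $q_{n+1}=0$, and let $z_0=(q_1,\dots,q_{n+1})\in(\mathbb{R}^2)^{n+1}$. With masses $\mu_1=\dots=\mu_n=1$, $\mu_{n+1}=m$, put $$U(z)=\sum_{1\le i<j\le n+1}\frac{\mu_i\mu_j}{|z_i-z_j|},\qquad I(z)=\frac12\sum_{i=1}^{n+1}\mu_i|z_i|^2 .$$ A central configuration is a collision-free critical point of $\sqrt I\,U$; it is called (nontrivially) degenerate if the kernel of the Hessian of $\sqrt I\,U$ at it contains a vector outside the span of the two trivial directions, namely the infinitesimal dilation $z$ and the infinitesimal rotation $(Jz_1,\dots,Jz_{n+1})$, where $J(x,y)=(-y,x)$. A number $m^*>0$ is a degeneracy value for $n$ if, for $m=m^*$, the configuration $z_0$ is a degenerate central configuration. Theorem (Multiplicity of degeneracy values). The number $N(n)$ of distinct degeneracy values $m^*>0$ is finite and equals $$N(3)=1,\qquad N(n)=\Big\lfloor\frac n2\Big\rfloor-1\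 (4\le n\le 6),\qquad N(n)=\Big\lfloor\frac n2\Big\rfloor-2\ (7\le n\le 9),\qquad N(n)=\Big\lfloor\frac n2\Big\rfloor-1\ (n\ge 10).$$ In particular, for $n\ge7$ the number $N(n)$ increases with $n$, in the sense that $N(n)\le N(n+1)$ and $N(n)<N(n+2)$ for all $n\ge 7$. -/

import Mathlib

noncomputable section

/-- The Euclidean plane. -/
abbrev Plane : Type := EuclideanSpace ℝ (Fin 2)

/-- Positions of `N` bodies in the plane, i.e. points of `ℝ ^ (2 N)`. -/
abbrev Config (N : ℕ) : Type := Fin N → Plane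

/-- The Newtonian potential `U = ∑_{i < j} μ i μ j / |q i - q j|`. -/
def newtonPotential {N : ℕ} (μ : Fin N → ℝ) (q : Config N) : ℝ :=
  ∑ i : Fin N, ∑ j ∈ Finset.Ioi i, μ i * μ j / ‖q i - q j‖

/-- The moment of inertia `I = (1/2) ∑ μ i |q i|²`. -/
def momentOfInertia {N : ℕ} (μ : Fin N → ℝ) (q : Config N) : ℝ :=
  (1 / 2) * ∑ i : Fin N, μ i * ‖q i‖ ^ 2

/-- The function `√I · U` on configurations. -/
def sqrtInertiaPotential {N : ℕ} (μ : Fin N → ℝ) (q : Config N) : ℝ :=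
  √(momentOfInertia μ q) * newtonPotential μ q

/-- A collision-free configuration is central if it is a critical point of `√I · U`. -/
def IsCentralConfiguration {N : ℕ} (μ : Fin N → ℝ) (q : Config N) : Prop :=
  Function.Injective q ∧ HasFDerivAt (sqrtInertiaPotential μ) (0 : Config N →L[ℝ] ℝ) q

/-- The Hessian of `√I · U` at `q`, as a bilinear form
`ξ η ↦ D²(√I · U)(q)(ξ, η)` on the configuration space. -/
def hessian {N : ℕ} (μ : Fin N → ℝ) (q : Config N) : Config N →L[ℝ] Config N →L[ℝ] ℝ :=
  fderiv ℝ (fderiv ℝ (sqrtInertiaPotential μ)) q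

/-- Rotation of the plane by a right angle. -/
def quarterTurn (x : Plane) : Plane := !₂[-x 1, x 0]

/-- The directions along which `√I · U` is constant for trivial reasons: the span of the
infinitesimal dilation `q` and the infinitesimal rotation `(quarterTurn (q i))_i`. -/
def trivialDirections {N : ℕ} (q : Config N) : Submodule ℝ (Config N) :=
  Submodule.span ℝ {q, fun i => quarterTurn (q i)}

/-- A central configuration is (nontrivially) degenerate if the kernel of the Hessian of
`√I · U` contains a vector outside the trivial directions. -/
def IsDegenerate {N : ℕ} (μ : Fin N → ℝ) (q : Config N) : Prop :=
  IsCentralConfiguration μ q ∧ ∃ ξ : Config N, hessian μ q ξ = 0 ∧ ξ ∉ trivialDirections q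

/-- The central + regular `n`-gon configuration: the `n` vertices
`(cos (k θ), sin (k θ))`, `k = 1, …, n`, `θ = 2 π / n`, followed by the origin. -/
def centeredPolygon (n : ℕ) : Config (n + 1) :=
  Fin.snoc (α := fun _ => Plane)
    (fun k : Fin n =>
      !₂[Real.cos (((k : ℕ) + 1 : ℝ) * (2 * Real.pi / n)),
        Real.sin (((k : ℕ) + 1 : ℝ) * (2 * Real.pi / n))])
    0

/-- Unit masses at the vertices and mass `m` at the center. -/
def centeredPolygonMass (n : ℕ) (m : ℝ) : Fin (n + 1) → ℝ :=
  Fin.snoc (α := fun _ => ℝ) (fun _ : Fin n => (1 : ℝ)) m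

/-- The positive values of the central mass for which the central + regular `n`-gon
configuration is degenerate. -/
def degeneracyValues (n : ℕ) : Set ℝ :=
  {m : ℝ | 0 < m ∧ IsDegenerate (centeredPolygonMass n m) (centeredPolygon n)}

end

/-! ### First and second derivatives of `√I · U`. -/

open scoped RealInnerProductSpace ComplexConjugate

/-! Write ω = exp(2πi/n), S_l = `ringSum l` and ⟨·,·⟩ for the mass inner product. The centered
polygon satisfies dU = -c dI with c = m + S_1. Homogeneity then shows that, modulo the dilation, the
kernel of the Hessian of √I·U is the kernel of D²U + c⟨·,·⟩ (`IsBalanced.isDegenerate_iff`). In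
complex notation, with the displacement of vertex j written as ω^j u_j, the equations on the ring
commute with rotation, so the discrete Fourier transform splits them into 2×2 real systems coupling
the frequencies l and -l. The center interacts only with l = ±1. Hence m is a degeneracy value
exactly when `modeDet n l m` vanishes for some 2 ≤ l ≤ n/2 or `firstModeDet n m` vanishes
(`isDegenerate_iff_modeDet`).

The quadratic terms in m cancel in all these determinants. Each `modeDet` has positive slope and the
single root `modeRoot n l`. The second difference of S_l is C_l = `ringCos n l`, and C_l - C_{l+1} =
cot((2l+1)π/2n). This gives monotonicity and convexity information strong enough to make `modeRoot n
l` strictly increasing for 1 ≤ l ≤ n/2 (`modeRoot_lt_succ`). The positive roots are therefore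
distinct and form a final segment of indices l ≥ a, so only its starting point a and the root of
`firstModeDet` remain to be found.

Both are settled by signs. `firstModeDet` has a positive root iff 8 S_1 < cot(π/2n) + 2n, which
holds exactly for n ≤ 6. The root for l = 2 has the sign of `secondModeForm n`, nonpositive for 4 ≤
n ≤ 9 and positive for n ≥ 10; the root for l = 3 is positive for 6 ≤ n ≤ 9. Small n are done by
Taylor enclosures of sines, n ≥ 13 by a harmonic-sum lower bound for S_1 (`large_ring_estimates`).
For n = 6 it is also checked that the two positive roots differ. -/

theorem hasFDerivAt_inv_norm {F : Type*} [NormedAddCommGroup F] [InnerProductSpace ℝ F]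
    {v : F} (hv : v ≠ 0) :
    HasFDerivAt (fun x : F => ‖x‖⁻¹) (-(‖v‖⁻¹ ^ 3) • innerSL ℝ v) v := by
  have h0 : ‖v‖ ≠ 0 := norm_ne_zero_iff.2 hv
  have h1 : HasFDerivAt (fun x : F => ‖x‖ ^ 2) (2 • innerSL ℝ v) v :=
    (hasStrictFDerivAt_norm_sq v).hasFDerivAt
  have h2 : HasFDerivAt (fun x : F => ‖x‖) ((1 / (2 * ‖v‖)) • 2 • innerSL ℝ v) v := by
    simpa only [Real.sqrt_sq (norm_nonneg _)] using h1.sqrt (by positivity)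
  refine ((hasDerivAt_inv h0).comp_hasFDerivAt v h2).congr_fderiv ?_
  ext w
  simp
  field_simp

theorem hasDerivAt_inv_norm_line {F : Type*} [NormedAddCommGroup F] [InnerProductSpace ℝ F]
    {d : F} (hd : d ≠ 0) (δ : F) :
    HasDerivAt (fun t : ℝ => ‖d + t • δ‖⁻¹) (-(‖d‖⁻¹ ^ 3) * ⟪d, δ⟫) 0 := by
  have h1 : HasDerivAt (fun t : ℝ => d + t • δ) δ 0 := by
    simpa using ((hasDerivAt_id (0 : ℝ)).smul_const δ).const_add d
  have h2 := HasFDerivAt.comp_hasDerivAt (0 : ℝ)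
    (hasFDerivAt_inv_norm (v := d + (0 : ℝ) • δ) (by simpa using hd)) h1
  simpa [Function.comp_def] using h2

/-- The differential of the Newtonian potential. -/
noncomputable def potentialDeriv {N : ℕ} (μ : Fin N → ℝ) (q : Config N) : Config N →L[ℝ] ℝ :=
  ∑ i : Fin N, ∑ j ∈ Finset.Ioi i, (μ i * μ j) •
    ((-(‖q i - q j‖⁻¹ ^ 3) • innerSL ℝ (q i - q j)) ∘L
      (ContinuousLinearMap.proj (R := ℝ) (φ := fun _ : Fin N => Plane) i - ContinuousLinearMap.proj j))

/-- The mass inner product with the configuration `q`, the differential of the moment of inertia. -/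
noncomputable def inertiaDeriv {N : ℕ} (μ : Fin N → ℝ) (q : Config N) : Config N →L[ℝ] ℝ :=
  ∑ i : Fin N, μ i • (innerSL ℝ (q i) ∘L ContinuousLinearMap.proj (R := ℝ) (φ := fun _ : Fin N => Plane) i)

/-- The second differential of the Newtonian potential. -/
noncomputable def potentialHess {N : ℕ} (μ : Fin N → ℝ) (q ξ η : Config N) : ℝ :=
  ∑ i : Fin N, ∑ j ∈ Finset.Ioi i, μ i * μ j *
    (3 * ‖q i - q j‖⁻¹ ^ 5 * ⟪q i - q j, ξ i - ξ j⟫ * ⟪q i - q j, η i - η j⟫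
      - ‖q i - q j‖⁻¹ ^ 3 * ⟪ξ i - ξ j, η i - η j⟫)

section
variable {N : ℕ} {μ : Fin N → ℝ} {q ξ η : Config N}

theorem potentialDeriv_apply : potentialDeriv μ q η =
    ∑ i : Fin N, ∑ j ∈ Finset.Ioi i, μ i * μ j *
      (-(‖q i - q j‖⁻¹ ^ 3) * ⟪q i - q j, η i - η j⟫) := by
  simp only [potentialDeriv, sum_apply]
  refine Finset.sum_congr rfl fun i _ => Finset.sum_congr rfl fun j _ => ?_
  simp only [smul_apply, ContinuousLinearMap.comp_apply, sub_apply, ContinuousLinearMap.proj_apply,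
    innerSL_apply_apply, smul_eq_mul]

theorem inertiaDeriv_apply : inertiaDeriv μ q η = ∑ i : Fin N, μ i * ⟪q i, η i⟫ := by
  simp [inertiaDeriv, sum_apply]

theorem inertiaDeriv_self : inertiaDeriv μ q q = 2 * momentOfInertia μ q := by
  simp [inertiaDeriv_apply, momentOfInertia]

theorem inertiaDeriv_comm : inertiaDeriv μ q η = inertiaDeriv μ η q := by
  simp only [inertiaDeriv_apply, real_inner_comm]

theorem inertiaDeriv_add : inertiaDeriv μ (q + ξ) η = inertiaDeriv μ q η + inertiaDeriv μ ξ η := by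
  rw [inertiaDeriv_comm, map_add, inertiaDeriv_comm, inertiaDeriv_comm (q := η)]

theorem inertiaDeriv_smul (t : ℝ) : inertiaDeriv μ (t • q) η = t * inertiaDeriv μ q η := by
  rw [inertiaDeriv_comm, map_smul, inertiaDeriv_comm, smul_eq_mul]

theorem hasFDerivAt_newtonPotential (hq : Function.Injective q) :
    HasFDerivAt (newtonPotential μ) (potentialDeriv μ q) q := by
  unfold newtonPotential potentialDeriv
  refine HasFDerivAt.fun_sum fun i _ => HasFDerivAt.fun_sum fun j hj => ?_
  have hd : q i - q j ≠ 0 := sub_ne_zero.2 fun h => (Finset.mem_Ioi.1 hj).ne (hq h)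
  simp only [div_eq_mul_inv]
  refine HasFDerivAt.const_mul ?_ _
  refine HasFDerivAt.comp q (hasFDerivAt_inv_norm hd)
    (f := fun q : Config N => q i - q j) ?_
  exact (hasFDerivAt_apply i q).sub (hasFDerivAt_apply j q)

theorem hasFDerivAt_momentOfInertia : HasFDerivAt (momentOfInertia μ) (inertiaDeriv μ q) q := by
  unfold momentOfInertia inertiaDeriv
  have h : HasFDerivAt (fun q : Config N => ∑ i : Fin N, μ i * ‖q i‖ ^ 2)
      (∑ i : Fin N, μ i • ((2 • innerSL ℝ (q i)) ∘L
        ContinuousLinearMap.proj (R := ℝ) (φ := fun _ : Fin N => Plane) i)) q := by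
    refine HasFDerivAt.fun_sum fun i _ => HasFDerivAt.const_mul ?_ _
    exact HasFDerivAt.comp q (hasStrictFDerivAt_norm_sq (q i)).hasFDerivAt
      (f := fun q : Config N => q i) (hasFDerivAt_apply i q)
  refine (h.const_mul (1 / 2 : ℝ)).congr_fderiv ?_
  ext1 v
  simp only [sum_apply, smul_apply, Finset.mul_sum, smul_eq_mul, ContinuousLinearMap.comp_apply,
    nsmul_eq_mul]
  refine Finset.sum_congr rfl fun i _ => ?_
  push_cast
  ring

theorem hasFDerivAt_sqrtInertiaPotential (hq : Function.Injective q)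
    (hI : momentOfInertia μ q ≠ 0) :
    HasFDerivAt (sqrtInertiaPotential μ)
      (√(momentOfInertia μ q) • potentialDeriv μ q + newtonPotential μ q •
        ((1 / (2 * √(momentOfInertia μ q))) • inertiaDeriv μ q)) q :=
  (hasFDerivAt_momentOfInertia.sqrt hI).mul (hasFDerivAt_newtonPotential hq)

theorem contDiffAt_sqrtInertiaPotential (hq : Function.Injective q)
    (hI : momentOfInertia μ q ≠ 0) : ContDiffAt ℝ 2 (sqrtInertiaPotential μ) q := by
  have ha : ∀ i : Fin N, ContDiffAt ℝ 2 (fun q : Config N => q i) q :=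
    fun i => (contDiff_apply ℝ Plane i).contDiffAt
  have h1 : ContDiffAt ℝ 2 (momentOfInertia μ) q :=
    contDiffAt_const.mul (ContDiffAt.sum fun i _ => contDiffAt_const.mul ((ha i).norm_sq ℝ))
  refine (h1.sqrt hI).mul (ContDiffAt.sum fun i _ => ContDiffAt.sum fun j hj => ?_)
  have hd : q i - q j ≠ 0 := sub_ne_zero.2 fun h => (Finset.mem_Ioi.1 hj).ne (hq h)
  exact contDiffAt_const.div (((ha i).sub (ha j)).norm ℝ hd) (norm_ne_zero_iff.2 hd)

theorem eventually_injective (hq : Function.Injective q) :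
    ∀ᶠ p in nhds q, Function.Injective p := by
  have : ∀ᶠ p : Config N in nhds q, ∀ i j, i ≠ j → p i ≠ p j := by
    refine Filter.eventually_all.2 fun i => Filter.eventually_all.2 fun j => ?_
    by_cases hij : i = j
    · simp [hij]
    · have : q i ≠ q j := fun h => hij (hq h)
      filter_upwards [(isOpen_ne_fun (f := fun p : Config N => p i) (g := fun p : Config N => p j)
        (continuous_apply i) (continuous_apply j)).mem_nhds this] with p hp _ using hp
  filter_upwards [this] with p hp i j h
  by_contra hne
  exact hp i j hne h

theorem hasDerivAt_potentialDeriv_line (hq : Function.Injective q) :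
    HasDerivAt (fun t : ℝ => potentialDeriv μ (q + t • ξ) η) (potentialHess μ q ξ η) 0 := by
  simp only [potentialDeriv_apply, potentialHess]
  refine HasDerivAt.fun_sum fun i _ => HasDerivAt.fun_sum fun j hj => ?_
  have hd : q i - q j ≠ 0 := sub_ne_zero.2 fun h => (Finset.mem_Ioi.1 hj).ne (hq h)
  refine HasDerivAt.const_mul _ ?_
  have e : ∀ t : ℝ, (q + t • ξ) i - (q + t • ξ) j = (q i - q j) + t • (ξ i - ξ j) := fun t => by
    simp only [Pi.add_apply, Pi.smul_apply]; module
  simp only [e]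
  have h1 : HasDerivAt (fun t : ℝ => ⟪(q i - q j) + t • (ξ i - ξ j), η i - η j⟫)
      ⟪ξ i - ξ j, η i - η j⟫ 0 := by
    simp only [inner_add_left, real_inner_smul_left]
    simpa using ((hasDerivAt_id (0 : ℝ)).mul_const ⟪ξ i - ξ j, η i - η j⟫).const_add
      ⟪q i - q j, η i - η j⟫
  have h2 := (((hasDerivAt_inv_norm_line hd (ξ i - ξ j)).fun_pow 3).fun_neg).mul h1
  refine h2.congr_deriv ?_
  simp only [zero_smul, add_zero]
  push_cast
  ring

theorem hasDerivAt_line : HasDerivAt (fun t : ℝ => q + t • ξ) ξ 0 := by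
  simpa using ((hasDerivAt_id (0 : ℝ)).smul_const ξ).const_add q

theorem HasFDerivAt.hasDerivAt_line {f : Config N → ℝ} {f' : Config N →L[ℝ] ℝ}
    (hf : HasFDerivAt f f' q) : HasDerivAt (fun t : ℝ => f (q + t • ξ)) (f' ξ) 0 := by
  have hq0 : q + (0 : ℝ) • ξ = q := by simp
  exact HasFDerivAt.comp_hasDerivAt (0 : ℝ) (by rwa [hq0]) _root_.hasDerivAt_line

/-- Since √I·U is C² near `q`, the iterated Fréchet derivative can be evaluated along lines; this
reduces the Hessian to a one-variable computation. -/
theorem hasDerivAt_fderiv_line (hq : Function.Injective q) (hI : momentOfInertia μ q ≠ 0) :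
    HasDerivAt (fun t : ℝ => fderiv ℝ (sqrtInertiaPotential μ) (q + t • ξ) η)
      (hessian μ q ξ η) 0 := by
  have hd : DifferentiableAt ℝ (fderiv ℝ (sqrtInertiaPotential μ)) q :=
    ((contDiffAt_sqrtInertiaPotential hq hI).fderiv_right
      (m := 1) (by norm_num)).differentiableAt one_ne_zero
  have h : HasFDerivAt (fun p => fderiv ℝ (sqrtInertiaPotential μ) p η)
      ((ContinuousLinearMap.apply ℝ ℝ η) ∘L hessian μ q) q :=
    (ContinuousLinearMap.apply ℝ ℝ η).hasFDerivAt.comp q hd.hasFDerivAt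
  exact h.hasDerivAt_line

theorem fderiv_eventuallyEq_line (hq : Function.Injective q) (hI : momentOfInertia μ q ≠ 0) :
    (fun t : ℝ => fderiv ℝ (sqrtInertiaPotential μ) (q + t • ξ) η) =ᶠ[nhds 0]
      fun t : ℝ => √(momentOfInertia μ (q + t • ξ)) *
      potentialDeriv μ (q + t • ξ) η + newtonPotential μ (q + t • ξ) *
      ((2 * √(momentOfInertia μ (q + t • ξ)))⁻¹ * inertiaDeriv μ (q + t • ξ) η) := by
  have e1 : ∀ᶠ p in nhds q, Function.Injective p ∧ momentOfInertia μ p ≠ 0 :=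
    (eventually_injective hq).and
      (hasFDerivAt_momentOfInertia.continuousAt.eventually_ne hI)
  have hc : Filter.Tendsto (fun t : ℝ => q + t • ξ) (nhds 0) (nhds q) := by
    simpa [ContinuousAt] using (hasDerivAt_line (q := q) (ξ := ξ)).continuousAt
  filter_upwards [hc.eventually e1] with t ht
  rw [(hasFDerivAt_sqrtInertiaPotential ht.1 ht.2).fderiv]
  simp

theorem hessian_apply (hq : Function.Injective q) (hI : 0 < momentOfInertia μ q) :
    hessian μ q ξ η = √(momentOfInertia μ q) * potentialHess μ q ξ η
      + (1 / (2 * √(momentOfInertia μ q))) *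
        (inertiaDeriv μ q ξ * potentialDeriv μ q η + potentialDeriv μ q ξ * inertiaDeriv μ q η
          + newtonPotential μ q * inertiaDeriv μ ξ η)
      - newtonPotential μ q * inertiaDeriv μ q ξ * inertiaDeriv μ q η /
        (4 * √(momentOfInertia μ q) ^ 3) := by
  have hq0 : q + (0 : ℝ) • ξ = q := by simp
  have hs0 : √(momentOfInertia μ q) ≠ 0 := (Real.sqrt_pos.2 hI).ne'
  have hs : HasDerivAt (fun t : ℝ => √(momentOfInertia μ (q + t • ξ)))
      (1 / (2 * √(momentOfInertia μ q)) * inertiaDeriv μ q ξ) 0 := by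
    simpa using (hasFDerivAt_momentOfInertia.sqrt hI.ne').hasDerivAt_line
  have hU := (hasFDerivAt_newtonPotential (μ := μ) hq).hasDerivAt_line (ξ := ξ)
  have hdI : HasDerivAt (fun t : ℝ => inertiaDeriv μ (q + t • ξ) η) (inertiaDeriv μ ξ η) 0 := by
    simp only [inertiaDeriv_add, inertiaDeriv_smul]
    simpa using ((hasDerivAt_id (0 : ℝ)).mul_const (inertiaDeriv μ ξ η)).const_add
      (inertiaDeriv μ q η)
  have h2 := (hs.fun_mul (hasDerivAt_potentialDeriv_line (μ := μ) (ξ := ξ) (η := η) hq)).fun_add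
      (hU.fun_mul (((hs.const_mul 2).fun_inv (by rw [hq0]; simpa using hs0)).fun_mul hdI))
  rw [(hasDerivAt_fderiv_line hq hI.ne').unique
    (h2.congr_of_eventuallyEq (fderiv_eventuallyEq_line hq hI.ne'))]
  simp only [zero_smul, add_zero]
  field_simp
  ring

/-! ### Degeneracy of a balanced configuration. -/

/-- A configuration balanced with multiplier `c`: `dU = -c dI`. -/
def IsBalanced (μ : Fin N → ℝ) (q : Config N) (c : ℝ) : Prop :=
  ∀ η, potentialDeriv μ q η = -c * inertiaDeriv μ q η

/-- Euler's identity: U is homogeneous of degree -1, and in `potentialHess_self` dU is homogeneous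
of degree -2. -/
theorem potentialDeriv_self (hq : Function.Injective q) :
    potentialDeriv μ q q = -newtonPotential μ q := by
  simp only [potentialDeriv_apply, newtonPotential, ← Finset.sum_neg_distrib]
  refine Finset.sum_congr rfl fun i _ => Finset.sum_congr rfl fun j hj => ?_
  have hd : ‖q i - q j‖ ≠ 0 :=
    norm_ne_zero_iff.2 (sub_ne_zero.2 fun h => (Finset.mem_Ioi.1 hj).ne (hq h))
  rw [real_inner_self_eq_norm_sq]
  field_simp

theorem potentialHess_self (hq : Function.Injective q) :
    potentialHess μ q q η = -2 * potentialDeriv μ q η := by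
  simp only [potentialDeriv_apply, potentialHess, Finset.mul_sum]
  refine Finset.sum_congr rfl fun i _ => Finset.sum_congr rfl fun j hj => ?_
  have hd : ‖q i - q j‖ ≠ 0 :=
    norm_ne_zero_iff.2 (sub_ne_zero.2 fun h => (Finset.mem_Ioi.1 hj).ne (hq h))
  rw [real_inner_self_eq_norm_sq]
  field_simp
  ring

theorem potentialHess_comm : potentialHess μ q ξ η = potentialHess μ q η ξ := by
  simp only [potentialHess]
  refine Finset.sum_congr rfl fun i _ => Finset.sum_congr rfl fun j hj => ?_
  rw [real_inner_comm (ξ i - ξ j) (η i - η j)]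
  ring

theorem potentialHess_sub_smul (t : ℝ) (ζ : Config N) :
    potentialHess μ q (ξ - t • ζ) η = potentialHess μ q ξ η - t * potentialHess μ q ζ η := by
  simp only [potentialHess, Finset.mul_sum, ← Finset.sum_sub_distrib]
  refine Finset.sum_congr rfl fun i _ => Finset.sum_congr rfl fun j hj => ?_
  have e : (ξ - t • ζ) i - (ξ - t • ζ) j = (ξ i - ξ j) - t • (ζ i - ζ j) := by
    simp only [Pi.sub_apply, Pi.smul_apply]; module
  rw [e]
  simp only [inner_sub_left (_ - _ : Plane) (_ • _), inner_sub_right _ (_ - _ : Plane) (_ • _),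
    real_inner_smul_left, real_inner_smul_right]
  ring

theorem IsBalanced.newtonPotential_eq {c : ℝ} (hb : IsBalanced μ q c) (hq : Function.Injective q) :
    newtonPotential μ q = 2 * c * momentOfInertia μ q := by
  have := hb q
  rw [potentialDeriv_self hq, inertiaDeriv_self] at this
  linarith

theorem IsBalanced.isCentralConfiguration {c : ℝ} (hb : IsBalanced μ q c)
    (hq : Function.Injective q) (hI : 0 < momentOfInertia μ q) :
    IsCentralConfiguration μ q := by
  refine ⟨hq, (hasFDerivAt_sqrtInertiaPotential hq hI.ne').congr_fderiv ?_⟩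
  ext1 η
  have hs := Real.sqrt_pos.2 hI
  simp only [add_apply, smul_apply, smul_eq_mul,
    zero_apply, hb η, hb.newtonPotential_eq hq]
  nth_rw 2 [← Real.sq_sqrt hI.le]
  field_simp
  ring

/-- At a balanced configuration the Hessian is √I times D²U + c⟨·,·⟩ minus a rank-one form built
from ⟨q,·⟩. By homogeneity D²U + c⟨·,·⟩ acts on `q` as 3c⟨q,·⟩, and the rank-one form cancels
precisely this. The two kernels thus differ only by the trivial direction `q`. -/
theorem IsBalanced.isDegenerate_iff {c : ℝ} (hb : IsBalanced μ q c) (hc : 0 < c)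
    (hq : Function.Injective q) (hI : 0 < momentOfInertia μ q) :
    IsDegenerate μ q ↔ ∃ ξ, (∀ η, potentialHess μ q ξ η + c * inertiaDeriv μ ξ η = 0) ∧
      ξ ∉ trivialDirections q := by
  have hs := Real.sqrt_pos.2 hI
  have hform : ∀ ξ η, hessian μ q ξ η = √(momentOfInertia μ q) *
      (potentialHess μ q ξ η + c * inertiaDeriv μ ξ η
        - (3 * c / (2 * momentOfInertia μ q)) * inertiaDeriv μ q ξ * inertiaDeriv μ q η) := by
    intro ξ η
    rw [hessian_apply hq hI, hb ξ, hb η, hb.newtonPotential_eq hq]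
    have hsq : momentOfInertia μ q = √(momentOfInertia μ q) ^ 2 := (Real.sq_sqrt hI.le).symm
    generalize √(momentOfInertia μ q) = s at *
    rw [hsq]
    field_simp
    ring
  have hq2 : ∀ η, potentialHess μ q q η = 2 * c * inertiaDeriv μ q η := by
    intro η
    rw [potentialHess_self hq, hb η]; ring
  have hqm : q ∈ trivialDirections q := Submodule.subset_span (by simp)
  constructor
  · rintro ⟨-, ξ, h0, hξ⟩
    -- The coefficient of the orthogonal projection of `ξ` onto `q`, because ⟨q,q⟩ = 2I.
    set t := (1 / (2 * momentOfInertia μ q)) * inertiaDeriv μ q ξ with ht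
    refine ⟨ξ - t • q, fun η => ?_, fun h => hξ ?_⟩
    · have h1 : hessian μ q ξ η = 0 := by rw [h0]; rfl
      rw [hform] at h1
      have h2 := (mul_eq_zero.1 h1).resolve_left hs.ne'
      have h3 : inertiaDeriv μ (ξ - t • q) η = inertiaDeriv μ ξ η - t * inertiaDeriv μ q η := by
        rw [sub_eq_add_neg, ← neg_smul, inertiaDeriv_add, inertiaDeriv_smul]; ring
      rw [potentialHess_sub_smul, h3, hq2, ← h2, ht]
      ring
    · simpa using (trivialDirections q).add_mem h ((trivialDirections q).smul_mem t hqm)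
  · rintro ⟨ξ, h0, hξ⟩
    refine ⟨hb.isCentralConfiguration hq hI, ξ, ?_, hξ⟩
    ext1 η
    -- Pairing the kernel equation with `q` gives 3c⟨q,ξ⟩ = 0, so the rank-one correction vanishes
    -- on `ξ`.
    have h1 : inertiaDeriv μ q ξ = 0 := by
      have := h0 q
      rw [potentialHess_comm, hq2, inertiaDeriv_comm (q := ξ)] at this
      have h3 : 3 * c * inertiaDeriv μ q ξ = 0 := by linarith
      exact (mul_eq_zero.1 h3).resolve_left (by positivity)
    rw [hform, h0, h1]
    simp

/-- Sums over pairs of an antisymmetric family of vectors, regrouped by particle. -/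
theorem sum_pairs_inner {v : Fin N → Fin N → Plane} (hv : ∀ i j, v j i = -v i j) :
    ∑ i : Fin N, ∑ j ∈ Finset.Ioi i, ⟪v i j, η i - η j⟫ = ∑ i, ⟪∑ j, v i j, η i⟫ := by
  have hv0 : ∀ i, v i i = 0 := fun i => by
    have : (2 : ℝ) • v i i = 0 := by rw [two_smul]; nth_rw 1 [hv i i]; simp
    exact (smul_eq_zero.1 this).resolve_left two_ne_zero
  have h1 : ∀ i, ∑ j, ⟪v i j, η i⟫ =
      ∑ j ∈ Finset.Ioi i, ⟪v i j, η i⟫ + ∑ j ∈ Finset.Iio i, ⟪v i j, η i⟫ := by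
    intro i
    rw [← Finset.sum_union (Finset.disjoint_left.2 fun j h1 h2 =>
      lt_asymm (Finset.mem_Ioi.1 h1) (Finset.mem_Iio.1 h2))]
    refine (Finset.sum_subset (Finset.subset_univ _) fun j _ hj => ?_).symm
    have : j = i := by
      simp only [Finset.mem_union, Finset.mem_Ioi, Finset.mem_Iio, not_or, not_lt] at hj
      exact le_antisymm hj.1 hj.2
    rw [this, hv0, inner_zero_left]
  have h2 : ∑ i : Fin N, ∑ j ∈ Finset.Iio i, ⟪v i j, η i⟫ =
      -∑ i : Fin N, ∑ j ∈ Finset.Ioi i, ⟪v i j, η j⟫ := by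
    rw [Finset.sum_comm' (t' := Finset.univ) (s' := fun j => Finset.Ioi j) (by simp),
      ← Finset.sum_neg_distrib]
    refine Finset.sum_congr rfl fun i _ => ?_
    rw [← Finset.sum_neg_distrib]
    refine Finset.sum_congr rfl fun j _ => ?_
    rw [hv i j, inner_neg_left]
  simp only [sum_inner, h1, Finset.sum_add_distrib, h2, inner_sub_right, Finset.sum_sub_distrib]
  ring

end

/-! ### Equations of the individual particles and complex coordinates. -/

section
variable {N : ℕ} {μ : Fin N → ℝ} {q ξ η : Config N}

theorem isBalanced_of_forall {c : ℝ}
    (h : ∀ i, ∑ j, (μ j * ‖q i - q j‖⁻¹ ^ 3) • (q i - q j) = c • q i) : IsBalanced μ q c := by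
  intro η
  have h1 : ∀ i j : Fin N, μ i * μ j * (-(‖q i - q j‖⁻¹ ^ 3) * ⟪q i - q j, η i - η j⟫) =
      ⟪(-(μ i * μ j * ‖q i - q j‖⁻¹ ^ 3)) • (q i - q j), η i - η j⟫ := fun i j => by
    rw [real_inner_smul_left]; ring
  rw [potentialDeriv_apply, inertiaDeriv_apply]
  simp only [h1]
  rw [sum_pairs_inner, Finset.mul_sum]
  · refine Finset.sum_congr rfl fun i _ => ?_
    have : ∑ j, (-(μ i * μ j * ‖q i - q j‖⁻¹ ^ 3)) • (q i - q j) = (-(μ i * c)) • q i := by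
      rw [neg_smul, mul_smul, ← h i, Finset.smul_sum, ← Finset.sum_neg_distrib]
      refine Finset.sum_congr rfl fun j _ => ?_
      module
    rw [this, real_inner_smul_left]
    ring
  · intro i j
    rw [norm_sub_rev (q j)]
    module

/-- The pair sum is regrouped by particle using the antisymmetry of the forces, and then tested on
displacements of a single particle; the nonzero masses are divided out. -/
theorem potentialHess_kernel_iff {c : ℝ} (hμ : ∀ i, μ i ≠ 0) :
    (∀ η, potentialHess μ q ξ η + c * inertiaDeriv μ ξ η = 0) ↔
      ∀ i, ∑ j, μ j • ((3 * ‖q i - q j‖⁻¹ ^ 5 * ⟪q i - q j, ξ i - ξ j⟫) • (q i - q j)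
        - ‖q i - q j‖⁻¹ ^ 3 • (ξ i - ξ j)) + c • ξ i = 0 := by
  set v : Fin N → Fin N → Plane := fun i j =>
    (3 * ‖q i - q j‖⁻¹ ^ 5 * ⟪q i - q j, ξ i - ξ j⟫) • (q i - q j)
        - ‖q i - q j‖⁻¹ ^ 3 • (ξ i - ξ j) with hv
  have h1 : ∀ η, potentialHess μ q ξ η + c * inertiaDeriv μ ξ η =
      ∑ i, μ i * ⟪∑ j, μ j • v i j + c • ξ i, η i⟫ := by
    intro η
    have h2 : potentialHess μ q ξ η = ∑ i, ⟪∑ j, (μ i * μ j) • v i j, η i⟫ := by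
      rw [← sum_pairs_inner]
      · simp only [potentialHess]
        refine Finset.sum_congr rfl fun i _ => Finset.sum_congr rfl fun j _ => ?_
        rw [real_inner_smul_left, hv, inner_sub_left (_ • _ : Plane), real_inner_smul_left,
          real_inner_smul_left]
      · intro i j
        simp only [hv]
        rw [norm_sub_rev (q j), ← neg_sub (q i), ← neg_sub (ξ i), inner_neg_neg]
        module
    rw [h2, inertiaDeriv_apply, Finset.mul_sum, ← Finset.sum_add_distrib]
    refine Finset.sum_congr rfl fun i _ => ?_
    have h4 : ∑ j, (μ i * μ j) • v i j = μ i • ∑ j, μ j • v i j := by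
      simp only [Finset.smul_sum, mul_smul]
    rw [inner_add_left, h4, real_inner_smul_left, real_inner_smul_left]
    ring
  simp only [h1]
  constructor
  · intro h i
    have h3 := h (Pi.single i (∑ j, μ j • v i j + c • ξ i))
    rw [Finset.sum_eq_single i (fun j _ hj => by simp [Pi.single_eq_of_ne hj]) (by simp),
      Pi.single_eq_same] at h3
    exact inner_self_eq_zero.1 ((mul_eq_zero.1 h3).resolve_left (hμ i))
  · intro h η
    exact Finset.sum_eq_zero fun i _ => by rw [h i, inner_zero_left, mul_zero]

/-- The plane as the complex numbers. -/
noncomputable def planeC : Plane ≃ₗᵢ[ℝ] ℂ := Complex.orthonormalBasisOneI.repr.symm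

theorem planeC_apply (x : Plane) : planeC x = x 0 + x 1 * Complex.I :=
  Complex.orthonormalBasisOneI_repr_symm_apply x

theorem planeC_quarterTurn (x : Plane) : planeC (quarterTurn x) = Complex.I * planeC x := by
  simp only [planeC_apply, quarterTurn]
  apply Complex.ext <;> simp

/-- The linearised attraction between two particles at relative position `d`, in the relative
direction `δ`. -/
noncomputable def tidal (d δ : ℂ) : ℂ :=
  1 / 2 * (‖d‖⁻¹ ^ 3 : ℝ) * δ + 3 / 2 * (‖d‖⁻¹ ^ 5 : ℝ) * d ^ 2 * conj δ

/-- Expanding the real inner product as (d̄δ + dδ̄)/2 splits the tidal map into its complex-linear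
and antilinear parts. Self-interaction terms have d = 0 and vanish, since `0⁻¹ = 0`. -/
theorem planeC_tidal (d δ : Plane) :
    planeC ((3 * ‖d‖⁻¹ ^ 5 * ⟪d, δ⟫) • d - ‖d‖⁻¹ ^ 3 • δ) = tidal (planeC d) (planeC δ) := by
  rw [map_sub, map_smul, map_smul, tidal, ← planeC.norm_map d, ← planeC.inner_map_map d δ]
  generalize planeC d = d
  generalize planeC δ = δ
  rcases eq_or_ne d 0 with rfl | hd
  · simp
  have h0 : (‖d‖ : ℂ) ≠ 0 := by simpa using hd
  have h1 : (⟪d, δ⟫ : ℂ) = (conj d * δ + d * conj δ) / 2 := by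
    rw [Complex.inner, Complex.re_eq_add_conj]
    simp
    ring
  have h2 : d * conj d = (‖d‖ : ℂ) ^ 2 := Complex.mul_conj' d
  simp only [Complex.real_smul]
  push_cast
  rw [h1]
  field_simp
  linear_combination (3 * δ) * h2

/-- The quarter turn is multiplication by i, so dilation and rotation together span one complex
line. -/
theorem mem_trivialDirections_iff : ξ ∈ trivialDirections q ↔
    ∃ t : ℂ, ∀ i, planeC (ξ i) = t * planeC (q i) := by
  rw [trivialDirections, Submodule.mem_span_pair]
  constructor
  · rintro ⟨a, b, rfl⟩
    refine ⟨a + b * Complex.I, fun i => ?_⟩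
    simp [planeC_quarterTurn]
    ring
  · rintro ⟨t, ht⟩
    refine ⟨t.re, t.im, funext fun i => planeC.injective ?_⟩
    rw [ht]
    simp only [Pi.add_apply, Pi.smul_apply, map_add, map_smul, planeC_quarterTurn,
      Complex.real_smul]
    linear_combination planeC (q i) * Complex.re_add_im t

theorem isDegenerate_iff_complex {c : ℝ} (hc : 0 < c) (hμ : ∀ i, μ i ≠ 0)
    (hq : Function.Injective q) (hI : 0 < momentOfInertia μ q) {z : Fin N → ℂ}
    (hz : ∀ i, planeC (q i) = z i)
    (h : ∀ i, ∑ j, (μ j : ℂ) * (‖z i - z j‖⁻¹ ^ 3 : ℝ) * (z i - z j) = c * z i) :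
    IsDegenerate μ q ↔ ∃ w : Fin N → ℂ,
      (∀ i, ∑ j, (μ j : ℂ) * tidal (z i - z j) (w i - w j) + c * w i = 0) ∧
      ¬ ∃ t : ℂ, ∀ i, w i = t * z i := by
  have hb : IsBalanced μ q c := by
    refine isBalanced_of_forall fun i => planeC.injective ?_
    have := h i
    simp only [← hz, ← map_sub, LinearIsometryEquiv.norm_map] at this
    rw [map_sum, map_smul, Complex.real_smul, ← this]
    refine Finset.sum_congr rfl fun j _ => ?_
    rw [map_smul, Complex.real_smul]
    push_cast
    ring
  rw [hb.isDegenerate_iff hc hq hI]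
  have key : ∀ ξ : Config N, (∀ η, potentialHess μ q ξ η + c * inertiaDeriv μ ξ η = 0) ↔
      ∀ i, ∑ j, (μ j : ℂ) * tidal (z i - z j) (planeC (ξ i) - planeC (ξ j)) +
        c * planeC (ξ i) = 0 := by
    intro ξ
    rw [potentialHess_kernel_iff hμ]
    refine forall_congr' fun i => ?_
    rw [← planeC.map_eq_zero_iff, map_add, map_sum, map_smul, Complex.real_smul]
    simp only [← hz, ← map_sub, ← planeC_tidal, map_smul, Complex.real_smul]
  simp only [key, mem_trivialDirections_iff, hz]
  constructor
  · rintro ⟨ξ, h1, h2⟩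
    exact ⟨fun i => planeC (ξ i), h1, h2⟩
  · rintro ⟨w, h1, h2⟩
    refine ⟨fun i => planeC.symm (w i), ?_, ?_⟩
    · simpa using h1
    · simpa using h2

end

/-! ### Fourier analysis of the linearised equations on the ring. -/

section
variable {n : ℕ} [NeZero n]

theorem norm_stdAddChar (j : ZMod n) : ‖ZMod.stdAddChar j‖ = 1 := by
  rw [ZMod.stdAddChar_apply]; exact Circle.norm_coe _

theorem stdAddChar_neg_mul (j : ZMod n) : ZMod.stdAddChar (-j) * ZMod.stdAddChar j = 1 := by
  rw [← AddChar.map_add_eq_mul]; simp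

theorem conj_stdAddChar (j : ZMod n) : conj (ZMod.stdAddChar j) = ZMod.stdAddChar (-j) := by
  have h : ZMod.stdAddChar j ≠ (0 : ℂ) := fun h => by simpa [h] using norm_stdAddChar j
  refine mul_right_cancel₀ h ?_
  rw [stdAddChar_neg_mul, mul_comm, Complex.mul_conj', norm_stdAddChar]
  simp

theorem sum_stdAddChar_mul (l : ZMod n) :
    ∑ j, ZMod.stdAddChar (l * j) = if l = 0 then (n : ℂ) else 0 := by
  have := AddChar.sum_mulShift l (ZMod.isPrimitive_stdAddChar n)
  simpa [mul_comm, ZMod.card] using this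

/-- The inverse cube of the distance between vertices `s` steps apart in the regular `n`-gon. -/
noncomputable def chordWeight (s : ZMod n) : ℝ := ‖(1 : ℂ) - ZMod.stdAddChar s‖⁻¹ ^ 3

theorem chordWeight_neg (s : ZMod n) : chordWeight (-s) = chordWeight s := by
  rw [chordWeight, chordWeight, ← conj_stdAddChar, ← RCLike.norm_conj]
  simp

/-- The `l`-th interaction coefficient of the regular `n`-gon. -/
noncomputable def ringSum (l : ZMod n) : ℝ :=
  ∑ s, chordWeight s * (1 - (ZMod.stdAddChar (l * s)).re)

theorem ringSum_neg (l : ZMod n) : ringSum (-l) = ringSum l := by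
  refine Finset.sum_congr rfl fun s _ => ?_
  rw [neg_mul, ← conj_stdAddChar, Complex.conj_re]

theorem ringSum_zero : ringSum (0 : ZMod n) = 0 := by
  simp [ringSum]

/-- The imaginary parts cancel in pairs under s ↦ -s. -/
theorem sum_chordWeight (l : ZMod n) :
    ∑ s, (chordWeight s : ℂ) * (1 - ZMod.stdAddChar (l * s)) = ringSum l := by
  have h : conj (∑ s, (chordWeight s : ℂ) * (1 - ZMod.stdAddChar (l * s))) =
      ∑ s, (chordWeight s : ℂ) * (1 - ZMod.stdAddChar (l * s)) := by
    rw [map_sum, ← Equiv.sum_comp (Equiv.neg (ZMod n))]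
    refine Finset.sum_congr rfl fun s _ => ?_
    simp [conj_stdAddChar, chordWeight_neg]
  rw [← Complex.conj_eq_iff_re.1 h]
  simp [ringSum]

theorem ringSum_one_pos (hn : 2 ≤ n) : 0 < ringSum (1 : ZMod n) := by
  have hre : ∀ j : ZMod n, (ZMod.stdAddChar j).re ≤ 1 := fun j =>
    (Complex.re_le_norm _).trans (norm_stdAddChar j).le
  have h1 : (1 : ZMod n) ≠ 0 := by
    have : Fact (1 < n) := ⟨by omega⟩
    exact one_ne_zero
  refine Finset.sum_pos' (fun s _ => mul_nonneg (by unfold chordWeight; positivity)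
    (by linarith [hre (1 * s)])) ⟨1, Finset.mem_univ _, ?_⟩
  have h2 : ZMod.stdAddChar (1 : ZMod n) ≠ (1 : ℂ) := fun h =>
    h1 (ZMod.injective_stdAddChar (by rw [h]; simp))
  have h3 : 0 < ‖(1 : ℂ) - ZMod.stdAddChar (1 : ZMod n)‖ := norm_pos_iff.2 (sub_ne_zero.2 h2.symm)
  refine mul_pos (by unfold chordWeight; positivity) (sub_pos.2 (lt_of_le_of_ne (hre _) ?_))
  intro h
  refine h2 (Complex.ext (by simpa using h) ?_)
  have h4 := Complex.sq_norm (ZMod.stdAddChar (1 : ZMod n))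
  rw [norm_stdAddChar, Complex.normSq_apply] at h4
  rw [mul_one] at h
  rw [h] at h4
  simpa using h4

/-- The equation of a ring particle, in the frame rotating with the vertices. -/
noncomputable def ringEq (m : ℝ) (u : ZMod n → ℂ) (c : ℂ) (j : ZMod n) : ℂ :=
  ∑ s, (chordWeight s : ℂ) * (1 / 2 * (u j - ZMod.stdAddChar s * u (j + s)) +
      3 / 2 * (conj (u (j + s)) - ZMod.stdAddChar s * conj (u j)))
    + m * (1 / 2 * (u j - ZMod.stdAddChar (-j) * c) +
      3 / 2 * (conj (u j) - ZMod.stdAddChar j * conj c))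
    + (m + ringSum (1 : ZMod n) : ℝ) * u j

/-- The equation of the central particle. -/
noncomputable def centerEq (m : ℝ) (u : ZMod n → ℂ) (c : ℂ) : ℂ :=
  ∑ k, (1 / 2 * (c - ZMod.stdAddChar k * u k) - 3 / 2 * (ZMod.stdAddChar k * conj (u k)))
    + (m + ringSum (1 : ZMod n) : ℝ) * c

/-- The point is (1 - ω^s)² = -ω^s |1 - ω^s|². It turns the antilinear part into a multiple of
`chordWeight s`, and after removal of the factor ω^j the coefficients depend on s alone. -/
theorem tidal_ring (u : ZMod n → ℂ) (j s : ZMod n) :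
    tidal (ZMod.stdAddChar j - ZMod.stdAddChar (j + s))
      (ZMod.stdAddChar j * u j - ZMod.stdAddChar (j + s) * u (j + s)) =
    ZMod.stdAddChar j * ((chordWeight s : ℂ) * (1 / 2 * (u j - ZMod.stdAddChar s * u (j + s)) +
      3 / 2 * (conj (u (j + s)) - ZMod.stdAddChar s * conj (u j)))) := by
  have h1 : ZMod.stdAddChar j - ZMod.stdAddChar (j + s) =
      ZMod.stdAddChar j * (1 - ZMod.stdAddChar s) := by
    rw [AddChar.map_add_eq_mul]; ring
  have hn : ‖ZMod.stdAddChar j * (1 - ZMod.stdAddChar s)‖ = ‖(1 : ℂ) - ZMod.stdAddChar s‖ := by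
    rw [norm_mul, norm_stdAddChar, one_mul]
  have hj := stdAddChar_neg_mul j
  have hs := stdAddChar_neg_mul s
  have h2 : ((‖(1 : ℂ) - ZMod.stdAddChar s‖ : ℝ) : ℂ) ^ 2 =
      (1 - ZMod.stdAddChar s) * (1 - ZMod.stdAddChar (-s)) := by
    rw [← Complex.mul_conj', map_sub, conj_stdAddChar, map_one]
  rw [tidal, h1, hn, AddChar.map_add_eq_mul, map_sub, map_mul, map_mul, map_mul,
    conj_stdAddChar, conj_stdAddChar, chordWeight]
  generalize conj (u j) = a at *
  generalize conj (u (j + s)) = b at *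
  generalize u (j + s) = b' at *
  generalize u j = a' at *
  -- The self-interaction s = 0 contributes nothing, again because `0⁻¹ = 0`.
  rcases eq_or_ne ((1 : ℂ) - ZMod.stdAddChar s) 0 with h0 | h0
  · simp [h0]
  have h3 : ((‖(1 : ℂ) - ZMod.stdAddChar s‖ : ℝ) : ℂ) ≠ 0 := by simpa using h0
  push_cast
  generalize ((‖(1 : ℂ) - ZMod.stdAddChar s‖ : ℝ) : ℂ) = r at *
  generalize ZMod.stdAddChar (-j) = e' at *
  generalize (ZMod.stdAddChar j : ℂ) = e at *
  generalize ZMod.stdAddChar (-s) = f' at *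
  generalize (ZMod.stdAddChar s : ℂ) = f at *
  have h4 : (1 - f) ^ 2 = -f * r ^ 2 := by
    linear_combination f * h2 + (f - 1) * hs
  have h5 : r⁻¹ ^ 5 * r ^ 2 = r⁻¹ ^ 3 := by field_simp
  rw [mul_pow, h4]
  linear_combination 3 / 2 * e * (e' * e) * (-f * a + f * f' * b) * h5 +
    3 / 2 * r⁻¹ ^ 3 * e * (-f * a + f * f' * b) * hj + 3 / 2 * r⁻¹ ^ 3 * e * b * hs

theorem tidal_ring_center (u c : ℂ) (j : ZMod n) :
    tidal (ZMod.stdAddChar j) (ZMod.stdAddChar j * u - c) =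
    ZMod.stdAddChar j * (1 / 2 * (u - ZMod.stdAddChar (-j) * c) +
      3 / 2 * (conj u - ZMod.stdAddChar j * conj c)) := by
  have hj := stdAddChar_neg_mul j
  rw [tidal, norm_stdAddChar, map_sub, map_mul, conj_stdAddChar]
  push_cast
  simp only [inv_one, one_pow, mul_one]
  linear_combination (1 / 2 * c + 3 / 2 * ZMod.stdAddChar j * conj u) * hj

/-- The last term is isolated because it sums to zero over the ring when n ≥ 3; this is why
`centerEq` contains no conjugate of `c`. -/
theorem tidal_center_ring (u c : ℂ) (j : ZMod n) :
    tidal (-ZMod.stdAddChar j) (c - ZMod.stdAddChar j * u) =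
    1 / 2 * (c - ZMod.stdAddChar j * u) - 3 / 2 * (ZMod.stdAddChar j * conj u) +
      3 / 2 * conj c * ZMod.stdAddChar (2 * j) := by
  have hj := stdAddChar_neg_mul j
  rw [tidal, norm_neg, norm_stdAddChar, map_sub, map_mul, conj_stdAddChar, two_mul,
    AddChar.map_add_eq_mul]
  push_cast
  simp only [inv_one, one_pow, mul_one]
  linear_combination (-3 / 2 * ZMod.stdAddChar j * conj u) * hj

/-- Conjugation exchanges the characters l and -l, so their span is invariant. The operator acts on
(a, b) through a real symmetric 2×2 matrix, whose determinant is `modeDet`. -/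
theorem ringEq_mode (m : ℝ) (a b c : ℂ) (l j : ZMod n) :
    ringEq m (fun j => a * ZMod.stdAddChar (l * j) + conj b * ZMod.stdAddChar (-(l * j))) c j =
      ((ringSum (l + 1) / 2 + 3 * m / 2 + ringSum (1 : ZMod n)) * a +
        (3 / 2 * (ringSum (1 : ZMod n) - ringSum l) + 3 * m / 2) * b) * ZMod.stdAddChar (l * j) +
      ((ringSum (l - 1) / 2 + 3 * m / 2 + ringSum (1 : ZMod n)) * conj b +
        (3 / 2 * (ringSum (1 : ZMod n) - ringSum l) + 3 * m / 2) * conj a) *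
          ZMod.stdAddChar (-(l * j)) -
      m * (1 / 2 * ZMod.stdAddChar (-j) * c + 3 / 2 * ZMod.stdAddChar j * conj c) := by
  have h1 := sum_chordWeight (l + 1)
  have h2 : ∑ s, (chordWeight s : ℂ) * (1 - ZMod.stdAddChar (-(l - 1) * s)) = ringSum (l - 1) := by
    rw [sum_chordWeight, ringSum_neg]
  have h3 : ∑ s, (chordWeight s : ℂ) * (1 - ZMod.stdAddChar (-l * s)) = ringSum l := by
    rw [sum_chordWeight, ringSum_neg]
  have h4 := sum_chordWeight l
  have h5 := sum_chordWeight (1 : ZMod n)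
  rw [ringEq, ← h1, ← h2]
  have h6 : ∑ s, (chordWeight s : ℂ) * (1 / 2 * ((a * ZMod.stdAddChar (l * j) +
        conj b * ZMod.stdAddChar (-(l * j))) - ZMod.stdAddChar s *
        (a * ZMod.stdAddChar (l * (j + s)) + conj b * ZMod.stdAddChar (-(l * (j + s))))) +
      3 / 2 * (conj (a * ZMod.stdAddChar (l * (j + s)) +
        conj b * ZMod.stdAddChar (-(l * (j + s)))) - ZMod.stdAddChar s *
        conj (a * ZMod.stdAddChar (l * j) + conj b * ZMod.stdAddChar (-(l * j))))) =
      1 / 2 * a * ZMod.stdAddChar (l * j) *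
        ∑ s, (chordWeight s : ℂ) * (1 - ZMod.stdAddChar ((l + 1) * s)) +
      1 / 2 * conj b * ZMod.stdAddChar (-(l * j)) *
        ∑ s, (chordWeight s : ℂ) * (1 - ZMod.stdAddChar (-(l - 1) * s)) +
      3 / 2 * conj a * ZMod.stdAddChar (-(l * j)) *
        (∑ s, (chordWeight s : ℂ) * (1 - ZMod.stdAddChar ((1 : ZMod n) * s)) -
        ∑ s, (chordWeight s : ℂ) * (1 - ZMod.stdAddChar (-l * s))) +
      3 / 2 * b * ZMod.stdAddChar (l * j) *
        (∑ s, (chordWeight s : ℂ) * (1 - ZMod.stdAddChar ((1 : ZMod n) * s)) -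
        ∑ s, (chordWeight s : ℂ) * (1 - ZMod.stdAddChar (l * s))) := by
    simp only [Finset.mul_sum, ← Finset.sum_sub_distrib, ← Finset.sum_add_distrib]
    refine Finset.sum_congr rfl fun s _ => ?_
    simp only [map_add, map_mul, conj_stdAddChar, Complex.conj_conj, neg_neg]
    have e0 : l * (j + s) = l * j + l * s := by ring
    have e1 : -(l * (j + s)) = -(l * j) + -l * s := by ring
    have e2 : (l + 1) * s = l * s + s := by ring
    have e3 : -(l - 1) * s = -l * s + s := by ring
    rw [e1, e2, e3, e0]
    simp only [AddChar.map_add_eq_mul, one_mul]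
    ring
  rw [h6, h3, h4, h5]
  simp only [map_add, map_mul, conj_stdAddChar, Complex.conj_conj, neg_neg]
  push_cast
  ring

/-- The converse side of `ringEq_mode`: it yields necessary conditions on the Fourier coefficients
of an arbitrary solution. By orthogonality of characters the center enters only at l = ±1. -/
theorem dft_ringEq (m : ℝ) (u : ZMod n → ℂ) (c : ℂ) (l : ZMod n) :
    ∑ j, ZMod.stdAddChar (-(l * j)) * ringEq m u c j =
      (ringSum (l + 1) / 2 + 3 * m / 2 + ringSum (1 : ZMod n)) *
        ∑ j, ZMod.stdAddChar (-(l * j)) * u j +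
      (3 / 2 * (ringSum (1 : ZMod n) - ringSum l) + 3 * m / 2) *
        ∑ j, ZMod.stdAddChar (-(l * j)) * conj (u j) -
      m * (1 / 2 * c * ∑ j, ZMod.stdAddChar (-(l + 1) * j) +
        3 / 2 * conj c * ∑ j, ZMod.stdAddChar ((1 - l) * j)) := by
  have hshift : ∀ (s : ZMod n) (f : ZMod n → ℂ), ∑ j, ZMod.stdAddChar (-(l * j)) * f (j + s) =
      ZMod.stdAddChar (l * s) * ∑ j, ZMod.stdAddChar (-(l * j)) * f j := by
    intro s f
    rw [← Equiv.sum_comp (Equiv.addRight s) (fun j => ZMod.stdAddChar (-(l * j)) * f j),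
      Finset.mul_sum]
    refine Finset.sum_congr rfl fun j _ => ?_
    have e1 : -(l * j) = -(l * (j + s)) + l * s := by ring
    simp only [Equiv.coe_addRight]
    rw [e1, AddChar.map_add_eq_mul]
    ring
  have h1 : ∑ j, ZMod.stdAddChar (-(l * j)) * ∑ s, (chordWeight s : ℂ) *
      (1 / 2 * (u j - ZMod.stdAddChar s * u (j + s)) +
      3 / 2 * (conj (u (j + s)) - ZMod.stdAddChar s * conj (u j))) =
      (∑ s, (chordWeight s : ℂ) * (1 - ZMod.stdAddChar ((l + 1) * s))) / 2 *
        ∑ j, ZMod.stdAddChar (-(l * j)) * u j +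
      3 / 2 * (∑ s, (chordWeight s : ℂ) * (1 - ZMod.stdAddChar ((1 : ZMod n) * s)) -
        ∑ s, (chordWeight s : ℂ) * (1 - ZMod.stdAddChar (l * s))) *
        ∑ j, ZMod.stdAddChar (-(l * j)) * conj (u j) := by
    conv_lhs => simp only [Finset.mul_sum]
    rw [Finset.sum_comm]
    have h2 : ∀ s, ∑ j, ZMod.stdAddChar (-(l * j)) * ((chordWeight s : ℂ) *
        (1 / 2 * (u j - ZMod.stdAddChar s * u (j + s)) +
        3 / 2 * (conj (u (j + s)) - ZMod.stdAddChar s * conj (u j)))) =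
        (chordWeight s : ℂ) * (1 / 2 * (∑ j, ZMod.stdAddChar (-(l * j)) * u j -
          ZMod.stdAddChar s * ∑ j, ZMod.stdAddChar (-(l * j)) * u (j + s)) +
        3 / 2 * (∑ j, ZMod.stdAddChar (-(l * j)) * conj (u (j + s)) -
          ZMod.stdAddChar s * ∑ j, ZMod.stdAddChar (-(l * j)) * conj (u j))) := by
      intro s
      simp only [Finset.mul_sum, ← Finset.sum_sub_distrib, ← Finset.sum_add_distrib]
      refine Finset.sum_congr rfl fun j _ => ?_
      ring
    simp only [h2, hshift, hshift _ (fun j => conj (u j))]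
    generalize ∑ j, ZMod.stdAddChar (-(l * j)) * u j = a
    generalize ∑ j, ZMod.stdAddChar (-(l * j)) * conj (u j) = b
    rw [← Finset.sum_sub_distrib, Finset.sum_div, Finset.mul_sum, Finset.sum_mul, Finset.sum_mul,
      ← Finset.sum_add_distrib]
    refine Finset.sum_congr rfl fun s _ => ?_
    rw [add_mul, one_mul, AddChar.map_add_eq_mul]
    ring
  rw [sum_chordWeight, sum_chordWeight, sum_chordWeight] at h1
  have h3 : ∑ j, ZMod.stdAddChar (-(l * j)) * (m * (1 / 2 * (u j - ZMod.stdAddChar (-j) * c) +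
      3 / 2 * (conj (u j) - ZMod.stdAddChar j * conj c))) =
      m / 2 * ∑ j, ZMod.stdAddChar (-(l * j)) * u j +
      3 * m / 2 * ∑ j, ZMod.stdAddChar (-(l * j)) * conj (u j) -
      m * (1 / 2 * c * ∑ j, ZMod.stdAddChar (-(l + 1) * j) +
        3 / 2 * conj c * ∑ j, ZMod.stdAddChar ((1 - l) * j)) := by
    simp only [Finset.mul_sum, ← Finset.sum_sub_distrib, ← Finset.sum_add_distrib]
    refine Finset.sum_congr rfl fun j _ => ?_
    have e1 : -(l + 1) * j = -(l * j) + -j := by ring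
    have e2 : (1 - l) * j = -(l * j) + j := by ring
    rw [e1, e2, AddChar.map_add_eq_mul, AddChar.map_add_eq_mul]
    ring
  have h4 : ∑ j, ZMod.stdAddChar (-(l * j)) * ((m + ringSum (1 : ZMod n) : ℝ) * u j) =
      (m + ringSum (1 : ZMod n) : ℝ) * ∑ j, ZMod.stdAddChar (-(l * j)) * u j := by
    rw [Finset.mul_sum]
    exact Finset.sum_congr rfl fun j _ => by ring
  have h5 : ∀ j, ZMod.stdAddChar (-(l * j)) * ringEq m u c j = _ := fun j => by
    rw [ringEq, mul_add, mul_add]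
  rw [Finset.sum_congr rfl fun j _ => h5 j, Finset.sum_add_distrib, Finset.sum_add_distrib,
    h1, h3, h4]
  push_cast
  ring

end

/-! ### The centered polygon in rotating complex coordinates. -/

theorem two_ne_zero_zmod {n : ℕ} (hn : 3 ≤ n) : (2 : ZMod n) ≠ 0 := by
  intro h
  have h1 : ((2 : ℕ) : ZMod n) = 0 := by exact_mod_cast h
  have := Nat.le_of_dvd (by norm_num) ((ZMod.natCast_eq_zero_iff _ _).1 h1)
  omega

section
variable {n : ℕ} [NeZero n]

/-- The vertices of the `n`-gon, numbered `1, …, n`, as residues modulo `n`. -/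
noncomputable def vertexEquiv (n : ℕ) [NeZero n] : Fin n ≃ ZMod n :=
  Equiv.ofBijective (fun k => ((k : ℕ) + 1 : ZMod n)) <| by
    rw [Fintype.bijective_iff_injective_and_card]
    refine ⟨fun a b h => Fin.ext ?_, by simp [ZMod.card]⟩
    have h1 : ((a : ℕ) : ZMod n) = ((b : ℕ) : ZMod n) := by simpa using h
    have h2 := (ZMod.natCast_eq_natCast_iff' _ _ _).1 h1
    rwa [Nat.mod_eq_of_lt a.2, Nat.mod_eq_of_lt b.2] at h2

/-- The configuration with ring particles `e j * u j` and central particle `c`. -/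
noncomputable def ringConfig (u : ZMod n → ℂ) (c : ℂ) : Fin (n + 1) → ℂ :=
  Fin.snoc (α := fun _ => ℂ)
    (fun k => ZMod.stdAddChar (vertexEquiv n k) * u (vertexEquiv n k)) c

theorem planeC_centeredPolygon (i : Fin (n + 1)) :
    planeC (centeredPolygon n i) = ringConfig (fun _ => 1) 0 i := by
  refine Fin.lastCases ?_ (fun k => ?_) i
  · simp [centeredPolygon, ringConfig]
  · simp only [centeredPolygon, ringConfig, Fin.snoc_castSucc, planeC_apply, mul_one, vertexEquiv,
      Equiv.ofBijective_apply]
    have h := ZMod.stdAddChar_coe (N := n) ((k : ℤ) + 1)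
    push_cast at h
    rw [h]
    have e : 2 * (Real.pi : ℂ) * Complex.I * ((k : ℕ) + 1) / n =
        (((((k : ℕ) + 1 : ℝ) * (2 * Real.pi / n)) : ℝ) : ℂ) * Complex.I := by
      push_cast; ring
    rw [e, Complex.exp_mul_I, ← Complex.ofReal_cos, ← Complex.ofReal_sin]
    simp

theorem ringConfig_one_injective : Function.Injective (ringConfig (n := n) (fun _ => 1) 0) := by
  have h0 : ∀ j : ZMod n, ZMod.stdAddChar j ≠ (0 : ℂ) := fun j h => by
    simpa [h] using norm_stdAddChar j
  intro i j
  refine Fin.lastCases ?_ (fun k => ?_) i <;> refine Fin.lastCases ?_ (fun k' => ?_) j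
  · simp
  · simpa [ringConfig] using fun h => absurd h.symm (h0 _)
  · simpa [ringConfig] using fun h => absurd h (h0 _)
  · intro h
    have h1 : ZMod.stdAddChar (vertexEquiv n k) = (ZMod.stdAddChar (vertexEquiv n k') : ℂ) := by
      simpa [ringConfig] using h
    rw [(vertexEquiv n).injective (ZMod.injective_stdAddChar h1)]

theorem momentOfInertia_centeredPolygon_pos (m : ℝ) :
    0 < momentOfInertia (centeredPolygonMass n m) (centeredPolygon n) := by
  have h : ∀ i, ‖centeredPolygon n i‖ = ‖ringConfig (n := n) (fun _ => 1) 0 i‖ := fun i => by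
    rw [← planeC_centeredPolygon, planeC.norm_map]
  rw [momentOfInertia, Fin.sum_univ_castSucc]
  simp only [h]
  simp [centeredPolygonMass, ringConfig]
  exact Nat.pos_of_ne_zero (NeZero.ne n)

theorem sum_tidal_ring (m : ℝ) (u : ZMod n → ℂ) (c : ℂ) (k : Fin n) :
    ∑ i, (centeredPolygonMass n m i : ℂ) *
        tidal (ringConfig (fun _ => 1) 0 k.castSucc - ringConfig (fun _ => 1) 0 i)
          (ringConfig u c k.castSucc - ringConfig u c i) +
      (m + ringSum (1 : ZMod n) : ℝ) * ringConfig u c k.castSucc =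
    ZMod.stdAddChar (vertexEquiv n k) * ringEq m u c (vertexEquiv n k) := by
  rw [Fin.sum_univ_castSucc]
  simp only [centeredPolygonMass, ringConfig, Fin.snoc_castSucc, Fin.snoc_last, mul_one, sub_zero,
    Complex.ofReal_one, one_mul]
  rw [Equiv.sum_comp (vertexEquiv n) (fun j => tidal (ZMod.stdAddChar (vertexEquiv n k) -
    ZMod.stdAddChar j) (ZMod.stdAddChar (vertexEquiv n k) * u (vertexEquiv n k) -
      ZMod.stdAddChar j * u j)), ← Equiv.sum_comp (Equiv.addLeft (vertexEquiv n k))]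
  simp only [Equiv.coe_addLeft, tidal_ring, tidal_ring_center]
  rw [← Finset.mul_sum, ringEq]
  ring

theorem sum_tidal_center (hn : 3 ≤ n) (m : ℝ) (u : ZMod n → ℂ) (c : ℂ) :
    ∑ i, (centeredPolygonMass n m i : ℂ) *
        tidal (ringConfig (fun _ => 1) 0 (Fin.last n) - ringConfig (fun _ => 1) 0 i)
          (ringConfig u c (Fin.last n) - ringConfig u c i) +
      (m + ringSum (1 : ZMod n) : ℝ) * ringConfig u c (Fin.last n) = centerEq m u c := by
  rw [Fin.sum_univ_castSucc]
  simp only [centeredPolygonMass, ringConfig, Fin.snoc_castSucc, Fin.snoc_last, mul_one, zero_sub,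
    Complex.ofReal_one, one_mul]
  rw [Equiv.sum_comp (vertexEquiv n) (fun j => tidal (-ZMod.stdAddChar j)
    (c - ZMod.stdAddChar j * u j))]
  simp only [tidal_center_ring]
  rw [Finset.sum_add_distrib, ← Finset.mul_sum, sum_stdAddChar_mul,
    if_neg (two_ne_zero_zmod hn), centerEq]
  simp [tidal]

theorem centeredPolygon_balanced (hn : 2 ≤ n) (m : ℝ) (i : Fin (n + 1)) :
    ∑ j, (centeredPolygonMass n m j : ℂ) * (‖ringConfig (n := n) (fun _ => 1) 0 i -
        ringConfig (fun _ => 1) 0 j‖⁻¹ ^ 3 : ℝ) *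
        (ringConfig (fun _ => 1) 0 i - ringConfig (fun _ => 1) 0 j) =
      (m + ringSum (1 : ZMod n) : ℝ) * ringConfig (fun _ => 1) 0 i := by
  rw [Fin.sum_univ_castSucc]
  refine Fin.lastCases ?_ (fun k => ?_) i
  · simp only [centeredPolygonMass, ringConfig, Fin.snoc_castSucc, Fin.snoc_last, mul_one, zero_sub,
      Complex.ofReal_one, one_mul, norm_neg, norm_stdAddChar]
    rw [Equiv.sum_comp (vertexEquiv n) (fun j => ((1⁻¹ ^ 3 : ℝ) : ℂ) * -ZMod.stdAddChar j)]
    have h1 : (1 : ZMod n) ≠ 0 := by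
      have : Fact (1 < n) := ⟨by omega⟩
      exact one_ne_zero
    have := sum_stdAddChar_mul (1 : ZMod n)
    rw [if_neg h1] at this
    simpa using this
  · simp only [centeredPolygonMass, ringConfig, Fin.snoc_castSucc, Fin.snoc_last, mul_one, sub_zero,
      Complex.ofReal_one, one_mul, norm_stdAddChar]
    rw [Equiv.sum_comp (vertexEquiv n) (fun j =>
      ((‖ZMod.stdAddChar (vertexEquiv n k) - ZMod.stdAddChar j‖⁻¹ ^ 3 : ℝ) : ℂ) *
        (ZMod.stdAddChar (vertexEquiv n k) - ZMod.stdAddChar j)),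
      ← Equiv.sum_comp (Equiv.addLeft (vertexEquiv n k))]
    have h1 : ∀ j s : ZMod n, ((‖ZMod.stdAddChar j - ZMod.stdAddChar (j + s)‖⁻¹ ^ 3 : ℝ) : ℂ) *
        (ZMod.stdAddChar j - ZMod.stdAddChar (j + s)) =
        ZMod.stdAddChar j * ((chordWeight s : ℂ) * (1 - ZMod.stdAddChar (1 * s))) := by
      intro j s
      have h2 : ZMod.stdAddChar j - ZMod.stdAddChar (j + s) =
          ZMod.stdAddChar j * (1 - ZMod.stdAddChar s) := by
        rw [AddChar.map_add_eq_mul]; ring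
      rw [h2, norm_mul, norm_stdAddChar, one_mul, one_mul, chordWeight]
      ring
    simp only [Equiv.coe_addLeft, h1]
    rw [← Finset.mul_sum, sum_chordWeight]
    push_cast
    ring

/-- In the rotating frame the polygon itself is u = 1, c = 0, so the trivial directions become the
constant `u` with `c = 0`. -/
theorem isDegenerate_iff_ringEq (hn : 3 ≤ n) {m : ℝ} (hm : 0 < m) :
    IsDegenerate (centeredPolygonMass n m) (centeredPolygon n) ↔
      ∃ (u : ZMod n → ℂ) (c : ℂ), (∀ j, ringEq m u c j = 0) ∧ centerEq m u c = 0 ∧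
        ¬ (c = 0 ∧ ∃ t, ∀ j, u j = t) := by
  have h0 : ∀ j : ZMod n, ZMod.stdAddChar j ≠ (0 : ℂ) := fun j h => by
    simpa [h] using norm_stdAddChar j
  have hμ : ∀ i, centeredPolygonMass n m i ≠ 0 := by
    intro i
    refine Fin.lastCases ?_ (fun k => ?_) i
    · simpa [centeredPolygonMass] using hm.ne'
    · simp [centeredPolygonMass]
  have hinj : Function.Injective (centeredPolygon n) := fun i j h =>
    ringConfig_one_injective (n := n) (by
      rw [← planeC_centeredPolygon, ← planeC_centeredPolygon, h])
  rw [isDegenerate_iff_complex (add_pos hm (ringSum_one_pos (n := n) (by omega))) hμ hinj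
    (momentOfInertia_centeredPolygon_pos m) planeC_centeredPolygon
    (centeredPolygon_balanced (by omega) m)]
  have key : ∀ (u : ZMod n → ℂ) (c : ℂ),
      ((∀ i, ∑ j, (centeredPolygonMass n m j : ℂ) *
        tidal (ringConfig (fun _ => 1) 0 i - ringConfig (fun _ => 1) 0 j)
          (ringConfig u c i - ringConfig u c j) +
        (m + ringSum (1 : ZMod n) : ℝ) * ringConfig u c i = 0) ∧
        ¬ ∃ t : ℂ, ∀ i, ringConfig u c i = t * ringConfig (fun _ => 1) 0 i) ↔
      (∀ j, ringEq m u c j = 0) ∧ centerEq m u c = 0 ∧ ¬ (c = 0 ∧ ∃ t, ∀ j, u j = t) := by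
    intro u c
    rw [Fin.forall_fin_succ', sum_tidal_center hn, and_assoc]
    simp only [sum_tidal_ring, Fin.forall_fin_succ' (n := n)]
    refine and_congr ?_ (and_congr Iff.rfl (not_congr ?_))
    · rw [(vertexEquiv n).forall_congr_left]
      simp [h0]
    · simp only [ringConfig, Fin.snoc_castSucc, Fin.snoc_last, mul_one, mul_zero]
      constructor
      · rintro ⟨t, h1, h2⟩
        refine ⟨h2, t, fun j => ?_⟩
        have h3 := h1 ((vertexEquiv n).symm j)
        rw [Equiv.apply_symm_apply, mul_comm t] at h3
        exact mul_left_cancel₀ (h0 j) h3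
      · rintro ⟨h1, t, h2⟩
        exact ⟨t, fun k => by rw [h2, mul_comm], h1⟩
  constructor
  · rintro ⟨w, hw⟩
    refine ⟨fun j => ZMod.stdAddChar (-j) * w ((vertexEquiv n).symm j).castSucc, w (Fin.last n),
      (key _ _).1 ?_⟩
    have : ringConfig (fun j => ZMod.stdAddChar (-j) * w ((vertexEquiv n).symm j).castSucc)
        (w (Fin.last n)) = w := by
      funext i
      refine Fin.lastCases ?_ (fun k => ?_) i
      · simp [ringConfig]
      · simp only [ringConfig, Fin.snoc_castSucc, Equiv.symm_apply_apply]
        rw [← mul_assoc, mul_comm (ZMod.stdAddChar _), stdAddChar_neg_mul, one_mul]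
    rwa [this]
  · rintro ⟨u, c, h⟩
    exact ⟨ringConfig u c, (key u c).2 h⟩

/-! ### Degeneracy as vanishing of a mode determinant. -/

/-- The determinant of the `l`-th Fourier mode, for `2 ≤ l ≤ n / 2`. -/
noncomputable def modeDet (n : ℕ) [NeZero n] (l : ℕ) (m : ℝ) : ℝ :=
  (ringSum (l + 1 : ZMod n) / 2 + 3 * m / 2 + ringSum (1 : ZMod n)) *
    (ringSum (l - 1 : ZMod n) / 2 + 3 * m / 2 + ringSum (1 : ZMod n)) -
  (3 / 2 * (ringSum (1 : ZMod n) - ringSum (l : ZMod n)) + 3 * m / 2) ^ 2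

/-- The determinant of the first Fourier mode, after removal of the translations. -/
noncomputable def firstModeDet (n : ℕ) [NeZero n] (m : ℝ) : ℝ :=
  (ringSum (2 : ZMod n) / 2 + 3 * m / 2 + ringSum (1 : ZMod n)) *
    ((n + 3 * m) / 2 + ringSum (1 : ZMod n)) - 9 / 4 * m * (m + n)

theorem ringSum_nonneg (l : ZMod n) : 0 ≤ ringSum l := by
  refine Finset.sum_nonneg fun s _ => mul_nonneg (by unfold chordWeight; positivity) ?_
  linarith [Complex.re_le_norm (ZMod.stdAddChar (l * s)), norm_stdAddChar (l * s)]

end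

section
variable {n : ℕ} [NeZero n]

theorem natCast_zmod_ne_zero {n l : ℕ} (h0 : 0 < l) (hl : l < n) : (l : ZMod n) ≠ 0 := by
  rw [Ne, ZMod.natCast_eq_zero_iff]
  exact fun h => absurd (Nat.le_of_dvd h0 h) (by omega)

theorem isDegenerate_of_modeDet_eq_zero (hn : 3 ≤ n) {m : ℝ} (hm : 0 < m) {l : ℕ} (h2 : 2 ≤ l)
    (hl : l ≤ n / 2) (hdet : modeDet n l m = 0) :
    IsDegenerate (centeredPolygonMass n m) (centeredPolygon n) := by
  rw [isDegenerate_iff_ringEq hn hm]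
  by_contra hcon
  push Not at hcon
  set P : ℝ := ringSum (l + 1 : ZMod n) / 2 + 3 * m / 2 + ringSum (1 : ZMod n) with hP
  set R : ℝ := ringSum (l - 1 : ZMod n) / 2 + 3 * m / 2 + ringSum (1 : ZMod n) with hR
  set Q : ℝ := 3 / 2 * (ringSum (1 : ZMod n) - ringSum (l : ZMod n)) + 3 * m / 2 with hQ
  have hPpos : 0 < P := by
    have h1 := ringSum_nonneg (l + 1 : ZMod n)
    have h3 := ringSum_nonneg (1 : ZMod n)
    rw [hP]; positivity
  have hdet' : (P : ℂ) * R - Q ^ 2 = 0 := by exact_mod_cast hdet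
  have hc0 : ((l : ZMod n) + 1) ≠ 0 := by
    exact_mod_cast natCast_zmod_ne_zero (n := n) (l := l + 1) (by omega) (by omega)
  have hc1 : (1 - (l : ZMod n)) ≠ 0 := by
    have := natCast_zmod_ne_zero (n := n) (l := l - 1) (by omega) (by omega)
    rw [Nat.cast_sub (by omega), Nat.cast_one] at this
    exact fun h => this (by linear_combination -h)
  -- The vector (a, b) = t(Q, -P) kills the first row of the mode matrix, and the second because PR
  -- = Q². The contradiction hypothesis then forces `u` to be constant. The center is unaffected, as
  -- l ≠ ±1 modulo n.
  have hmode : ∀ t : ℂ, ∃ v : ℂ, ∀ j : ZMod n,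
      t * Q * ZMod.stdAddChar ((l : ZMod n) * j) + conj (-(t * P)) *
        ZMod.stdAddChar (-((l : ZMod n) * j)) = v := by
    intro t
    refine (hcon _ 0 (fun j => ?_) ?_).2
    · rw [ringEq_mode]
      have e1 : ((ringSum (l + 1 : ZMod n) : ℝ) / 2 + 3 * m / 2 + ringSum (1 : ZMod n) : ℂ) = P := by
        rw [hP]; push_cast; ring
      have e2 : ((ringSum (l - 1 : ZMod n) : ℝ) / 2 + 3 * m / 2 + ringSum (1 : ZMod n) : ℂ) = R := by
        rw [hR]; push_cast; ring
      have e3 : (3 / 2 * ((ringSum (1 : ZMod n) : ℝ) - ringSum (l : ZMod n)) + 3 * m / 2 : ℂ) = Q := by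
        rw [hQ]; push_cast; ring
      rw [e1, e2, e3]
      simp only [map_neg, map_mul, Complex.conj_ofReal, map_zero]
      linear_combination (-conj t * ZMod.stdAddChar (-((l : ZMod n) * j))) * hdet'
    · rw [centerEq]
      have h3 : ∀ k : ZMod n, (1 / 2 * (0 - ZMod.stdAddChar k * (t * Q * ZMod.stdAddChar ((l : ZMod n) * k) +
          conj (-(t * P)) * ZMod.stdAddChar (-((l : ZMod n) * k)))) - 3 / 2 * (ZMod.stdAddChar k *
          conj (t * Q * ZMod.stdAddChar ((l : ZMod n) * k) +
          conj (-(t * P)) * ZMod.stdAddChar (-((l : ZMod n) * k)))) : ℂ) =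
          (-1 / 2 * (t * Q) + 3 / 2 * (t * P)) * ZMod.stdAddChar (((l : ZMod n) + 1) * k) +
          (1 / 2 * conj (t * P) - 3 / 2 * conj (t * Q)) * ZMod.stdAddChar ((1 - (l : ZMod n)) * k) := by
        intro k
        have e1 : ((l : ZMod n) + 1) * k = l * k + k := by ring
        have e2 : (1 - (l : ZMod n)) * k = -(l * k) + k := by ring
        rw [e1, e2, AddChar.map_add_eq_mul, AddChar.map_add_eq_mul]
        simp only [map_add, map_neg, map_mul, conj_stdAddChar, Complex.conj_conj, neg_neg,
          Complex.conj_ofReal]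
        ring
      rw [Finset.sum_congr rfl fun k _ => h3 k, Finset.sum_add_distrib, ← Finset.mul_sum,
        ← Finset.mul_sum, sum_stdAddChar_mul, sum_stdAddChar_mul, if_neg hc0, if_neg hc1]
      simp
  obtain ⟨v, hv⟩ := hmode 1
  obtain ⟨w, hw⟩ := hmode Complex.I
  -- One value of t is not enough: for 2l = n the two characters coincide and the mode vanishes for
  -- t = 1 when P = Q. Combining t = 1 with t = i leaves only the P-part, and P > 0.
  have h4 : ∀ j : ZMod n, 2 * (P : ℂ) * ZMod.stdAddChar (-((l : ZMod n) * j)) = -v - Complex.I * w := by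
    intro j
    rw [← hv j, ← hw j]
    simp only [map_neg, map_mul, Complex.conj_ofReal, Complex.conj_I, map_one]
    linear_combination (Q * ZMod.stdAddChar ((l : ZMod n) * j) +
      P * ZMod.stdAddChar (-((l : ZMod n) * j))) * Complex.I_sq
  have h5 := (h4 1).trans (h4 0).symm
  have h6 : (2 * (P : ℂ)) ≠ 0 := by
    have : (P : ℂ) ≠ 0 := by exact_mod_cast hPpos.ne'
    simpa using this
  have h7 := ZMod.injective_stdAddChar (mul_left_cancel₀ h6 h5)
  exact natCast_zmod_ne_zero (n := n) (l := l) (by omega) (by omega) (by simpa using h7)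

theorem isDegenerate_of_firstModeDet_eq_zero (hn : 3 ≤ n) {m : ℝ} (hm : 0 < m)
    (hdet : firstModeDet n m = 0) :
    IsDegenerate (centeredPolygonMass n m) (centeredPolygon n) := by
  rw [isDegenerate_iff_ringEq hn hm]
  set S : ℝ := ringSum (1 : ZMod n) with hS
  set A : ℝ := ringSum (2 : ZMod n) / 2 + 3 * m / 2 + S with hA
  have hS0 : 0 < S := ringSum_one_pos (by omega)
  -- The coefficients 3m/2 and γ - A solve the ω^j equation for every displacement γ of the center;
  -- this γ solves the ω^(-j) equation, and `hdet` then gives the center equation.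
  set γ : ℝ := ((3 * m / 2 + S) * A - 9 / 4 * m ^ 2) / (m + S) with hγ
  have hγ' : (m + S) * γ = (3 * m / 2 + S) * A - 9 / 4 * m ^ 2 := by
    rw [hγ]; field_simp
  have hγC : (m + S : ℂ) * γ = (3 * m / 2 + S) * A - 9 / 4 * m ^ 2 := by
    simpa using congrArg Complex.ofReal hγ'
  have hdet' : (A : ℂ) * ((n + 3 * m) / 2 + S) - 9 / 4 * m * (m + n) = 0 := by
    simpa [firstModeDet, hA, hS] using congrArg Complex.ofReal hdet
  have h2 : (2 : ZMod n) ≠ 0 := two_ne_zero_zmod hn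
  have h1 : (1 : ZMod n) ≠ 0 := by
    exact_mod_cast natCast_zmod_ne_zero (n := n) (l := 1) (by omega) (by omega)
  refine ⟨fun j => (3 * m / 2 : ℝ) * ZMod.stdAddChar (1 * j) +
    conj ((γ - A : ℝ) : ℂ) * ZMod.stdAddChar (-(1 * j)), γ, fun j => ?_, ?_, ?_⟩
  · rw [ringEq_mode, one_add_one_eq_two, sub_self (1 : ZMod n), ringSum_zero]
    simp only [Complex.conj_ofReal, one_mul]
    have e1 : ((ringSum (2 : ZMod n) : ℝ) / 2 + 3 * m / 2 + S : ℂ) = A := by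
      rw [hA]; push_cast; ring
    rw [e1]
    push_cast
    linear_combination ZMod.stdAddChar (-j) * hγC
  · rw [centerEq]
    have h3 : ∀ k : ZMod n, (1 / 2 * ((γ : ℂ) - ZMod.stdAddChar k * ((3 * m / 2 : ℝ) *
        ZMod.stdAddChar (1 * k) + conj ((γ - A : ℝ) : ℂ) * ZMod.stdAddChar (-(1 * k)))) -
        3 / 2 * (ZMod.stdAddChar k * conj ((3 * m / 2 : ℝ) *
        ZMod.stdAddChar (1 * k) + conj ((γ - A : ℝ) : ℂ) * ZMod.stdAddChar (-(1 * k))))) =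
        (A / 2 - 9 / 4 * m : ℂ) + (-(3 * m / 4) - 3 / 2 * (γ - A) : ℂ) *
          ZMod.stdAddChar (2 * k) := by
      intro k
      rw [two_mul, AddChar.map_add_eq_mul, one_mul]
      simp only [map_add, map_mul, conj_stdAddChar, neg_neg, Complex.conj_ofReal]
      push_cast
      linear_combination (-1 / 2 * (γ - A) - 9 / 4 * m) * stdAddChar_neg_mul k
    rw [Finset.sum_congr rfl fun k _ => h3 k, Finset.sum_add_distrib, ← Finset.mul_sum,
      sum_stdAddChar_mul, if_neg h2]
    simp only [Finset.sum_const, Finset.card_univ, ZMod.card, nsmul_eq_mul]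
    push_cast
    linear_combination hγC + hdet'
  · rintro ⟨-, t, ht⟩
    -- A constant `u` has zero Fourier coefficient at l = 1, whereas here it is n · 3m/2.
    have h3 : ∑ j : ZMod n, ZMod.stdAddChar (-1 * j) * ((3 * m / 2 : ℝ) * ZMod.stdAddChar (1 * j) +
        conj ((γ - A : ℝ) : ℂ) * ZMod.stdAddChar (-(1 * j))) = 0 := by
      simp only [ht]
      rw [← Finset.sum_mul, sum_stdAddChar_mul, if_neg (neg_ne_zero.2 h1), zero_mul]
    have h4 : ∀ j : ZMod n, ZMod.stdAddChar (-1 * j) * ((3 * m / 2 : ℝ) * ZMod.stdAddChar (1 * j) +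
        conj ((γ - A : ℝ) : ℂ) * ZMod.stdAddChar (-(1 * j))) = (3 * m / 2 : ℝ) +
        ((γ - A : ℝ) : ℂ) * ZMod.stdAddChar (-2 * j) := by
      intro j
      have e : -2 * j = -j + -j := by ring
      rw [e, AddChar.map_add_eq_mul, neg_mul, one_mul, Complex.conj_ofReal]
      linear_combination (3 * m / 2 : ℝ) * stdAddChar_neg_mul j
    rw [Finset.sum_congr rfl fun j _ => h4 j, Finset.sum_add_distrib, ← Finset.mul_sum,
      sum_stdAddChar_mul, if_neg (neg_ne_zero.2 h2)] at h3
    simp only [Finset.sum_const, Finset.card_univ, ZMod.card, nsmul_eq_mul, mul_zero, add_zero] at h3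
    have hn0 : (n : ℂ) ≠ 0 := by exact_mod_cast NeZero.ne n
    have h5 := (mul_eq_zero.1 h3).resolve_left hn0
    have h6 : 3 * m / 2 = 0 := by exact_mod_cast h5
    linarith

theorem conj_dft (u : ZMod n → ℂ) (l : ZMod n) :
    conj (∑ j, ZMod.stdAddChar (-(l * j)) * u j) =
      ∑ j, ZMod.stdAddChar (-(-l * j)) * conj (u j) := by
  rw [map_sum]
  refine Finset.sum_congr rfl fun j _ => ?_
  rw [map_mul, conj_stdAddChar, neg_mul]

theorem eq_const_of_dft_eq_zero {u : ZMod n → ℂ}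
    (h : ∀ l : ZMod n, l ≠ 0 → ∑ j, ZMod.stdAddChar (-(l * j)) * u j = 0) :
    ∃ t, ∀ j, u j = t := by
  refine ⟨(n : ℂ)⁻¹ * ∑ j, u j, fun j => ?_⟩
  have h1 : ∀ l : ZMod n, ZMod.dft u l = ∑ j, ZMod.stdAddChar (-(l * j)) * u j := fun l => by
    simp only [ZMod.dft_apply, smul_eq_mul, mul_comm l]
  have h2 := congrFun (ZMod.dft.symm_apply_apply u) j
  rw [ZMod.invDFT_apply, Finset.sum_eq_single 0 (fun l _ hl => by rw [h1, h l hl, smul_zero])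
    (by simp), h1] at h2
  simpa using h2.symm

/-- Conjugating the transformed equation at -l gives the second equation for the transforms of u and
ū at l, which closes the 2×2 system. -/
theorem dft_system {m : ℝ} {u : ZMod n → ℂ} {c : ℂ} (h : ∀ j, ringEq m u c j = 0) (l : ZMod n) :
    (ringSum (l - 1) / 2 + 3 * m / 2 + ringSum (1 : ZMod n)) *
        ∑ j, ZMod.stdAddChar (-(l * j)) * conj (u j) +
      (3 / 2 * (ringSum (1 : ZMod n) - ringSum l) + 3 * m / 2) *
        ∑ j, ZMod.stdAddChar (-(l * j)) * u j -
      m * (1 / 2 * conj c * ∑ j, ZMod.stdAddChar ((1 - l) * j) +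
        3 / 2 * c * ∑ j, ZMod.stdAddChar (-(l + 1) * j)) = 0 := by
  have h1 := dft_ringEq m u c (-l)
  simp only [h, mul_zero, Finset.sum_const_zero] at h1
  have h2 := congrArg conj h1.symm
  simp only [map_sub, map_add, map_mul, Complex.conj_ofReal, Complex.conj_conj, map_zero,
    map_div₀, neg_neg, map_ofNat, map_one, map_sum, conj_stdAddChar] at h2
  rw [ringSum_neg, show -l + 1 = -(l - 1) by ring, ringSum_neg] at h2
  rw [← h2]
  have e2 : ∀ j : ZMod n, -((1 - -l) * j) = -(l + 1) * j := fun j => by ring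
  simp only [e2, neg_neg]
  have e3 : ∀ j : ZMod n, -((l - 1) * j) = (1 - l) * j := fun j => by ring
  simp only [e3, neg_mul]

theorem modeDet_eq_zero_of_isDegenerate (hn : 3 ≤ n) {m : ℝ} (hm : 0 < m)
    (hdeg : IsDegenerate (centeredPolygonMass n m) (centeredPolygon n)) :
    firstModeDet n m = 0 ∨ ∃ l, 2 ≤ l ∧ l ≤ n / 2 ∧ modeDet n l m = 0 := by
  rw [isDegenerate_iff_ringEq hn hm] at hdeg
  obtain ⟨u, c, hu, hc, hnot⟩ := hdeg
  by_contra hcon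
  push Not at hcon
  obtain ⟨hd1, hd2⟩ := hcon
  set F : ZMod n → ℂ := fun l => ∑ j, ZMod.stdAddChar (-(l * j)) * u j with hF
  set G : ZMod n → ℂ := fun l => ∑ j, ZMod.stdAddChar (-(l * j)) * conj (u j) with hG
  have hFG : ∀ l, F (-l) = conj (G l) := fun l => by
    simp only [hF, hG]
    rw [conj_dft]
    simp
  have hsys1 : ∀ l, (ringSum (l + 1) / 2 + 3 * m / 2 + ringSum (1 : ZMod n)) * F l +
      (3 / 2 * (ringSum (1 : ZMod n) - ringSum l) + 3 * m / 2) * G l -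
      m * (1 / 2 * c * ∑ j, ZMod.stdAddChar (-(l + 1) * j) +
        3 / 2 * conj c * ∑ j, ZMod.stdAddChar ((1 - l) * j)) = 0 := fun l => by
    have := dft_ringEq m u c l
    simp only [hu, mul_zero, Finset.sum_const_zero] at this
    exact this.symm
  have hsys2 : ∀ l, _ := dft_system hu
  have hS0 : 0 < ringSum (1 : ZMod n) := ringSum_one_pos (by omega)
  have hfirst : F 1 = 0 ∧ G 1 = 0 ∧ c = 0 := by
    have h1 := hsys1 1
    have h2 := hsys2 1
    have h22 : -(1 + 1 : ZMod n) ≠ 0 := by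
      rw [one_add_one_eq_two]; exact neg_ne_zero.2 (two_ne_zero_zmod hn)
    simp only [sum_stdAddChar_mul, sub_self, if_true, if_neg h22, ringSum_zero] at h1 h2
    have h3 := congrArg conj hc
    rw [centerEq, map_add, map_sum, map_zero] at h3
    have h4 : ∀ k : ZMod n, conj (1 / 2 * (c - ZMod.stdAddChar k * u k) -
        3 / 2 * (ZMod.stdAddChar k * conj (u k))) = 1 / 2 * conj c -
        1 / 2 * (ZMod.stdAddChar (-(1 * k)) * conj (u k)) -
        3 / 2 * (ZMod.stdAddChar (-(1 * k)) * u k) := by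
      intro k
      simp only [map_sub, map_mul, map_div₀, map_one, map_ofNat, Complex.conj_conj,
        conj_stdAddChar, one_mul]
      ring
    have h5 : ∑ k : ZMod n, (1 / 2 * conj c - 1 / 2 * (ZMod.stdAddChar (-(1 * k)) * conj (u k)) -
        3 / 2 * (ZMod.stdAddChar (-(1 * k)) * u k)) =
        n * (1 / 2 * conj c) - 1 / 2 * G 1 - 3 / 2 * F 1 := by
      simp only [hF, hG, Finset.sum_sub_distrib, Finset.mul_sum]
      simp
    rw [Finset.sum_congr rfl fun k _ => h4 k, h5, map_mul, Complex.conj_ofReal] at h3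
    change _ * G 1 + _ * F 1 - _ = (0 : ℂ) at h2
    rw [one_add_one_eq_two] at h1
    have hd1' : ((ringSum (2 : ZMod n) / 2 + 3 * m / 2 + ringSum (1 : ZMod n)) *
      ((n + 3 * m) / 2 + ringSum (1 : ZMod n)) - 9 / 4 * m * (m + n) : ℂ) ≠ 0 := by
      intro h
      exact hd1 (Complex.ofReal_injective (by simpa [firstModeDet] using h))
    push_cast at h2 h3
    have hn0 : (n : ℂ) ≠ 0 := by exact_mod_cast NeZero.ne n
    have hlam : (m + ringSum (1 : ZMod n) : ℂ) ≠ 0 := by exact_mod_cast (add_pos hm hS0).ne'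
    generalize F 1 = f at *
    generalize G 1 = g at *
    generalize (ringSum (1 : ZMod n) : ℂ) = S at *
    generalize (ringSum (2 : ZMod n) : ℂ) = T at *
    -- The combinations f and g - n c̄ vanish on translations. In them the equations form a 2×2
    -- system with determinant `firstModeDet`; the translation part carries the nonzero factor m +
    -- S_1, which finally gives c = 0.
    have hf : f = 0 := by
      refine (mul_eq_zero.1 ?_).resolve_left hd1'
      linear_combination ((n + 3 * m) / 2 + S) * h1 - (3 * m / 2) * (h2 - n * h3)
    have hg : g - n * conj c = 0 := by
      refine (mul_eq_zero.1 ?_).resolve_left hd1'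
      linear_combination (T / 2 + 3 * m / 2 + S) * (h2 - n * h3) - (3 * (m + n) / 2) * h1
    have hc' : conj c = 0 := by
      refine (mul_eq_zero.1 ?_).resolve_left (mul_ne_zero hn0 hlam)
      rw [hf] at h2
      linear_combination h2 - (S + 3 * m / 2) * hg
    refine ⟨hf, ?_, by simpa using hc'⟩
    rw [hc'] at hg
    linear_combination hg
  have hmode : ∀ l : ℕ, 1 ≤ l → l ≤ n / 2 → F l = 0 ∧ G l = 0 := by
    intro l h1 h2
    rcases h1.eq_or_lt with rfl | h1
    · simpa using ⟨hfirst.1, hfirst.2.1⟩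
    have e1 := hsys1 l
    have e2 := hsys2 l
    rw [hfirst.2.2] at e1 e2
    simp only [map_zero, mul_zero, zero_mul, add_zero, sub_zero] at e1 e2
    change _ * G l + _ * F l = 0 at e2
    have hd := hd2 l h1 h2
    have hd' : ((ringSum (l + 1 : ZMod n) / 2 + 3 * m / 2 + ringSum (1 : ZMod n)) *
      (ringSum (l - 1 : ZMod n) / 2 + 3 * m / 2 + ringSum (1 : ZMod n)) -
      (3 / 2 * (ringSum (1 : ZMod n) - ringSum (l : ZMod n)) + 3 * m / 2) ^ 2 : ℂ) ≠ 0 := by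
      intro h
      exact hd (Complex.ofReal_injective (by simpa [modeDet] using h))
    constructor
    · refine (mul_eq_zero.1 ?_).resolve_left hd'
      linear_combination (ringSum (l - 1 : ZMod n) / 2 + 3 * m / 2 + ringSum (1 : ZMod n)) * e1 -
        (3 / 2 * (ringSum (1 : ZMod n) - ringSum (l : ZMod n)) + 3 * m / 2) * e2
    · refine (mul_eq_zero.1 ?_).resolve_left hd'
      linear_combination (ringSum (l + 1 : ZMod n) / 2 + 3 * m / 2 + ringSum (1 : ZMod n)) * e2 -
        (3 / 2 * (ringSum (1 : ZMod n) - ringSum (l : ZMod n)) + 3 * m / 2) * e1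
  refine hnot ⟨hfirst.2.2, eq_const_of_dft_eq_zero fun l hl => ?_⟩
  change F l = 0
  have hv0 : 0 < l.val := Nat.pos_of_ne_zero fun h => hl ((ZMod.val_eq_zero l).1 h)
  have hvn := ZMod.val_lt l
  rcases le_or_gt l.val (n / 2) with h | h
  · have := (hmode l.val hv0 h).1
    rwa [ZMod.natCast_zmod_val] at this
  -- Frequencies above n/2 are recovered from n - l through F(-l) = conj G(l).
  · have h3 := (hmode (n - l.val) (by omega) (by omega)).2
    rw [Nat.cast_sub hvn.le, ZMod.natCast_self, ZMod.natCast_zmod_val, zero_sub] at h3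
    rw [← neg_neg l, hFG, h3, map_zero]

theorem isDegenerate_iff_modeDet (hn : 3 ≤ n) {m : ℝ} (hm : 0 < m) :
    IsDegenerate (centeredPolygonMass n m) (centeredPolygon n) ↔
      firstModeDet n m = 0 ∨ ∃ l, 2 ≤ l ∧ l ≤ n / 2 ∧ modeDet n l m = 0 := by
  refine ⟨modeDet_eq_zero_of_isDegenerate hn hm, ?_⟩
  rintro (h | ⟨l, h2, hl, h⟩)
  · exact isDegenerate_of_firstModeDet_eq_zero hn hm h
  · exact isDegenerate_of_modeDet_eq_zero hn hm h2 hl h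

end

/-! ### Interaction coefficients and monotonicity of the roots. -/

section
variable {n : ℕ} [NeZero n]

theorem sum_zmod_eq_sum_range (f : ZMod n → ℝ) : ∑ s, f s = ∑ s ∈ Finset.range n, f s := by
  symm
  refine Finset.sum_nbij' (fun s : ℕ => (s : ZMod n)) ZMod.val (by simp)
    (fun s _ => Finset.mem_range.2 (ZMod.val_lt s))
    (fun s hs => ZMod.val_cast_of_lt (Finset.mem_range.1 hs))
    (fun s _ => ZMod.natCast_zmod_val s) (by simp)

theorem stdAddChar_natCast_re (k : ℕ) :
    (ZMod.stdAddChar (k : ZMod n)).re = Real.cos (2 * Real.pi * k / n) := by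
  have h := ZMod.stdAddChar_coe (N := n) (k : ℤ)
  push_cast at h
  rw [h]
  have e : 2 * (Real.pi : ℂ) * Complex.I * k / n =
      ((2 * Real.pi * k / n : ℝ) : ℂ) * Complex.I := by
    push_cast; ring
  rw [e, Complex.exp_ofReal_mul_I_re]

theorem norm_one_sub_stdAddChar_sq (s : ZMod n) :
    ‖(1 : ℂ) - ZMod.stdAddChar s‖ ^ 2 = 2 * (1 - (ZMod.stdAddChar s).re) := by
  have h := Complex.sq_norm (ZMod.stdAddChar s)
  rw [norm_stdAddChar, Complex.normSq_apply] at h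
  rw [Complex.sq_norm, Complex.normSq_apply]
  simp only [Complex.sub_re, Complex.sub_im, Complex.one_re, Complex.one_im]
  linear_combination -h

theorem norm_one_sub_stdAddChar {s : ℕ} (hs : s < n) :
    ‖(1 : ℂ) - ZMod.stdAddChar (s : ZMod n)‖ = 2 * Real.sin (Real.pi * s / n) := by
  have h0 : 0 ≤ Real.sin (Real.pi * s / n) := by
    refine Real.sin_nonneg_of_nonneg_of_le_pi (by positivity) ?_
    rw [div_le_iff₀ (by exact_mod_cast (by omega : 0 < n))]
    have : (s : ℝ) ≤ n := by exact_mod_cast hs.le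
    nlinarith [Real.pi_pos]
  rw [← sq_eq_sq₀ (norm_nonneg _) (by positivity), norm_one_sub_stdAddChar_sq,
    stdAddChar_natCast_re]
  have e : 2 * Real.pi * s / n = 2 * (Real.pi * s / n) := by ring
  rw [e, Real.cos_two_mul, Real.cos_sq']
  ring

/-- Fourier coefficients of the inverse distances between the vertices of the `n`-gon. -/
noncomputable def ringCos (n l : ℕ) : ℝ :=
  ∑ s ∈ Finset.range n, (2 * Real.sin (Real.pi * s / n))⁻¹ * Real.cos (2 * Real.pi * (l * s) / n)

/-- Second differencing in l multiplies the term cos(2πls/n) by |1 - ω^s|² up to sign, lowering the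
inverse cube of the chord to its inverse. -/
theorem ringSum_second_diff (l : ℕ) :
    ringSum ((l : ZMod n) + 1) - 2 * ringSum (l : ZMod n) + ringSum ((l : ZMod n) - 1) =
      ringCos n l := by
  have h : ringCos n l = ∑ s : ZMod n, ‖(1 : ℂ) - ZMod.stdAddChar s‖⁻¹ *
      (ZMod.stdAddChar ((l : ZMod n) * s)).re := by
    rw [sum_zmod_eq_sum_range, ringCos]
    refine Finset.sum_congr rfl fun s hs => ?_
    have e : (l : ZMod n) * s = ((l * s : ℕ) : ZMod n) := by push_cast; rfl
    rw [norm_one_sub_stdAddChar (Finset.mem_range.1 hs), e, stdAddChar_natCast_re]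
    push_cast
    rfl
  rw [h, ringSum, ringSum, ringSum, Finset.mul_sum, ← Finset.sum_sub_distrib,
    ← Finset.sum_add_distrib]
  refine Finset.sum_congr rfl fun s _ => ?_
  have e1 : ((l : ZMod n) + 1) * s = l * s + s := by ring
  have e2 : ((l : ZMod n) - 1) * s = l * s + -s := by ring
  have h1 := norm_one_sub_stdAddChar_sq s
  rw [e1, e2, AddChar.map_add_eq_mul, AddChar.map_add_eq_mul, ← conj_stdAddChar, chordWeight]
  simp only [Complex.mul_re, Complex.conj_re, Complex.conj_im]
  rcases eq_or_ne ‖(1 : ℂ) - ZMod.stdAddChar s‖ 0 with h0 | h0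
  · simp [h0]
  · field_simp
    rw [h1]
    ring

theorem ringSum_one : ringSum (1 : ZMod n) = ringCos n 0 / 2 := by
  have h := ringSum_second_diff (n := n) 0
  simp only [Nat.cast_zero, zero_add, zero_sub, ringSum_neg, ringSum_zero] at h
  linarith

theorem sum_range_sin (α : ℝ) (n : ℕ) : 2 * Real.sin (α / 2) * ∑ s ∈ Finset.range n,
    Real.sin (α * s) = Real.cos (α / 2) - Real.cos (α * n - α / 2) := by
  induction n with
  | zero => simp
  | succ k ih =>
    rw [Finset.sum_range_succ, mul_add, ih]
    have e1 : α * ((k + 1 : ℕ) : ℝ) - α / 2 = α * k + α / 2 := by push_cast; ring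
    rw [e1, Real.cos_add, Real.cos_sub]
    ring

/-- The half-angles `(2 l + 1) π / (2 n)`. -/
noncomputable def halfAngle (n l : ℕ) : ℝ := (2 * l + 1) * Real.pi / (2 * n)

/-- The difference of the two cosines contains the factor 2 sin(πs/n), which cancels the chord and
leaves a geometric sine sum. -/
theorem ringCos_sub_succ {n l : ℕ} (hl : l < n) :
    ringCos n l - ringCos n (l + 1) = Real.cot (halfAngle n l) := by
  have hn : 0 < (n : ℝ) := by exact_mod_cast (by omega : 0 < n)
  have hpi := Real.pi_pos
  set α : ℝ := (2 * l + 1) * Real.pi / n with hα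
  have hh : halfAngle n l = α / 2 := by rw [halfAngle, hα]; field_simp
  have h1 : ringCos n l - ringCos n (l + 1) = ∑ s ∈ Finset.range n, Real.sin (α * s) := by
    rw [ringCos, ringCos, ← Finset.sum_sub_distrib]
    refine Finset.sum_congr rfl fun s hs => ?_
    rcases Nat.eq_zero_or_pos s with rfl | hs0
    · simp
    have hs1 : (s : ℝ) < n := by exact_mod_cast Finset.mem_range.1 hs
    have hs2 : (0 : ℝ) < s := by exact_mod_cast hs0
    have hpos : 0 < Real.sin (Real.pi * s / n) := by
      refine Real.sin_pos_of_pos_of_lt_pi (by positivity) ?_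
      rw [div_lt_iff₀ hn]
      nlinarith
    have e1 : 2 * Real.pi * (l * s) / n = α * s - Real.pi * s / n := by rw [hα]; field_simp; ring
    have e2 : 2 * Real.pi * ((l + 1 : ℕ) * s) / n = α * s + Real.pi * s / n := by
      rw [hα]; push_cast; field_simp; ring
    rw [e1, e2, Real.cos_add, Real.cos_sub]
    field_simp
    ring
  have hsin : 0 < Real.sin (α / 2) := by
    have hl' : (l : ℝ) + 1 ≤ n := by exact_mod_cast hl
    refine Real.sin_pos_of_pos_of_lt_pi (by positivity) ?_
    rw [hα, div_div, div_lt_iff₀ (by positivity)]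
    nlinarith
  have h2 := sum_range_sin α n
  -- Here αn is the odd multiple (2l+1)π, so the two boundary cosines add up instead of cancelling.
  have e3 : α * n - α / 2 = (Real.pi - α / 2) + (l : ℕ) * (2 * Real.pi) := by
    rw [hα]; field_simp; ring
  rw [e3, Real.cos_add_nat_mul_two_pi, Real.cos_pi_sub] at h2
  rw [h1, hh, Real.cot_eq_cos_div_sin, eq_div_iff hsin.ne']
  linarith

theorem ringCos_sub {l : ℕ} (hl : l ≤ n) : ringCos n (n - l) = ringCos n l := by
  have hn : (n : ℝ) ≠ 0 := by exact_mod_cast NeZero.ne n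
  refine Finset.sum_congr rfl fun s _ => ?_
  have e : 2 * Real.pi * ((n - l : ℕ) * s) / n =
      -(2 * Real.pi * (l * s) / n) + s * (2 * Real.pi) := by
    rw [Nat.cast_sub hl]; field_simp; ring
  rw [e, Real.cos_add_nat_mul_two_pi, Real.cos_neg]

/-- The `l`-th interaction coefficient, indexed by natural numbers. -/
noncomputable def ringCoeff (n : ℕ) [NeZero n] (l : ℕ) : ℝ := ringSum (l : ZMod n)

theorem ringCoeff_nonneg (l : ℕ) : 0 ≤ ringCoeff n l := ringSum_nonneg _

theorem ringCoeff_zero : ringCoeff n 0 = 0 := by simp [ringCoeff, ringSum_zero]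

theorem ringCoeff_one_pos (hn : 2 ≤ n) : 0 < ringCoeff n 1 := by
  simpa [ringCoeff] using ringSum_one_pos hn

theorem ringCoeff_sub {l : ℕ} (hl : l ≤ n) : ringCoeff n (n - l) = ringCoeff n l := by
  rw [ringCoeff, Nat.cast_sub hl, ZMod.natCast_self, zero_sub, ringSum_neg, ringCoeff]

theorem ringCoeff_add_two (l : ℕ) :
    ringCoeff n (l + 2) - ringCoeff n (l + 1) = ringCoeff n (l + 1) - ringCoeff n l +
      ringCos n (l + 1) := by
  have h := ringSum_second_diff (n := n) (l + 1)
  have e1 : ((l + 1 : ℕ) : ZMod n) + 1 = ((l + 2 : ℕ) : ZMod n) := by push_cast; ring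
  have e2 : ((l + 1 : ℕ) : ZMod n) - 1 = (l : ZMod n) := by push_cast; ring
  rw [e1, e2] at h
  simp only [ringCoeff]
  linarith

theorem ringCos_zero : ringCos n 0 = 2 * ringCoeff n 1 := by
  rw [ringCoeff, Nat.cast_one, ringSum_one]; ring

theorem cot_halfAngle_pos {n l : ℕ} (hl : 2 * l + 1 < n) : 0 < Real.cot (halfAngle n l) := by
  have hn : 0 < (n : ℝ) := by exact_mod_cast (by omega : 0 < n)
  have hl' : (2 * l + 1 : ℝ) < n := by exact_mod_cast hl
  have hpi := Real.pi_pos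
  have h0 : 0 < halfAngle n l := by unfold halfAngle; positivity
  have h1 : halfAngle n l < Real.pi / 2 := by
    rw [halfAngle, div_lt_div_iff₀ (by positivity) two_pos]
    nlinarith
  rw [Real.cot_eq_cos_div_sin]
  exact div_pos (Real.cos_pos_of_mem_Ioo ⟨by linarith, h1⟩)
    (Real.sin_pos_of_pos_of_lt_pi h0 (by linarith))

theorem ringCos_le {n l j : ℕ} (hlj : l ≤ j) (hj : 2 * j ≤ n) : ringCos n j ≤ ringCos n l := by
  induction j, hlj using Nat.le_induction with
  | base => exact le_rfl
  | succ j hj' ih =>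
    have h1 := ringCos_sub_succ (n := n) (l := j) (by omega)
    have h2 := cot_halfAngle_pos (n := n) (l := j) (by omega)
    linarith [ih (by omega)]

theorem ringCos_le_of_le_sub {l j : ℕ} (hlj : l ≤ j) (hj : j ≤ n - l) (hl : l ≤ n) :
    ringCos n j ≤ ringCos n l := by
  rcases le_total (2 * j) n with h | h
  · exact ringCos_le hlj h
  · rw [← ringCos_sub (n := n) (l := j) (by omega)]
    exact ringCos_le (by omega) (by omega)

theorem ringCoeff_diff_eq_sum {a b : ℕ} (hab : a ≤ b) :
    ringCoeff n (b + 1) - ringCoeff n b = ringCoeff n (a + 1) - ringCoeff n a +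
      ∑ j ∈ Finset.Ico a b, ringCos n (j + 1) := by
  induction b, hab using Nat.le_induction with
  | base => simp
  | succ b hb ih =>
    rw [Finset.sum_Ico_succ_top hb, ringCoeff_add_two, ih]
    ring

/-- The coefficients increase up to `n / 2`, and their increments do not drop too fast. -/
theorem ringCoeff_diff_pos {l : ℕ} (hl : 2 * l + 2 ≤ n) :
    0 < ringCoeff n (l + 1) - ringCoeff n l ∧
      -ringCos n l ≤ 2 * (ringCoeff n (l + 1) - ringCoeff n l) := by
  have hS := ringCoeff_one_pos (n := n) (by omega)
  -- If C_l ≥ 0 then all earlier C_j are nonnegative too, and the increment is at least the initial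
  -- one, S_1.
  rcases le_or_gt 0 (ringCos n l) with h | h
  · have h1 := ringCoeff_diff_eq_sum (n := n) (Nat.zero_le l)
    have h2 : 0 ≤ ∑ j ∈ Finset.Ico 0 l, ringCos n (j + 1) :=
      Finset.sum_nonneg fun j hj => h.trans
        (ringCos_le (by have := (Finset.mem_Ico.1 hj).2; omega) (by omega))
    rw [zero_add, ringCoeff_zero] at h1
    constructor <;> linarith
  -- By the reflection S_{n-k} = S_k, the increment at n-1-l is the negative of that at l. So minus
  -- twice the increment equals the sum of C_j for l < j ≤ n-1-l, a nonempty sum of terms at most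
  -- C_l < 0.
  · have h1 := ringCoeff_diff_eq_sum (n := n) (a := l) (b := n - 1 - l) (by omega)
    have e1 : n - 1 - l + 1 = n - l := by omega
    have e2 : n - 1 - l = n - (l + 1) := by omega
    rw [e1, ringCoeff_sub (by omega), e2, ringCoeff_sub (by omega)] at h1
    have h2 : ∑ j ∈ Finset.Ico l (n - (l + 1)), ringCos n (j + 1) ≤ ringCos n l := by
      have h3 : ∑ j ∈ Finset.Ico l (n - (l + 1)), ringCos n (j + 1) ≤
          ∑ j ∈ Finset.Ico l (n - (l + 1)), ringCos n l :=
        Finset.sum_le_sum fun j hj => by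
          have := Finset.mem_Ico.1 hj
          exact ringCos_le_of_le_sub (by omega) (by omega) (by omega)
      rw [Finset.sum_const, Nat.card_Ico, nsmul_eq_mul] at h3
      have h4 : (1 : ℝ) ≤ ((n - (l + 1) - l : ℕ) : ℝ) := by
        exact_mod_cast (by omega : 1 ≤ n - (l + 1) - l)
      nlinarith
    constructor <;> linarith

theorem ringCoeff_one_le {l : ℕ} (h1 : 1 ≤ l) (hl : 2 * l ≤ n) : ringCoeff n 1 ≤ ringCoeff n l := by
  induction l, h1 using Nat.le_induction with
  | base => exact le_rfl
  | succ l h ih => linarith [ih (by omega), (ringCoeff_diff_pos (n := n) (l := l) (by omega)).1]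

/-- The slope of `modeDet`, up to the factor `3 / 2`. -/
noncomputable def modeSlope (n : ℕ) [NeZero n] (l : ℕ) : ℝ :=
  (ringCoeff n (l + 1) + ringCoeff n (l - 1)) / 2 + 3 * ringCoeff n l - ringCoeff n 1

/-- The root of `modeDet`. -/
noncomputable def modeRoot (n : ℕ) [NeZero n] (l : ℕ) : ℝ :=
  (3 * ringCoeff n l - 5 * ringCoeff n 1 - (ringCoeff n (l + 1) + ringCoeff n (l - 1)) / 2 +
    ((ringCoeff n (l + 1) - ringCoeff n (l - 1)) / 2) ^ 2 / modeSlope n l) / 6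

theorem modeSlope_pos {l : ℕ} (h1 : 1 ≤ l) (hl : 2 * l ≤ n) : 0 < modeSlope n l := by
  have hS := ringCoeff_one_pos (n := n) (by omega)
  rw [modeSlope]
  linarith [ringCoeff_one_le h1 hl, ringCoeff_nonneg (n := n) (l + 1),
    ringCoeff_nonneg (n := n) (l - 1)]

/-- The m² terms of the product and of the square are both 9/4 and cancel, so the determinant is
affine in m. -/
theorem modeDet_eq {l : ℕ} (h1 : 1 ≤ l) (hl : 2 * l ≤ n) (m : ℝ) :
    modeDet n l m = 3 / 2 * modeSlope n l * (m - modeRoot n l) := by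
  have hW := modeSlope_pos (n := n) h1 hl
  have e1 : ((l : ZMod n) + 1) = ((l + 1 : ℕ) : ZMod n) := by push_cast; ring
  have e2 : ((l : ZMod n) - 1) = ((l - 1 : ℕ) : ZMod n) := by
    rw [Nat.cast_sub h1]; push_cast; ring
  have e3 : ringSum (1 : ZMod n) = ringCoeff n 1 := by simp [ringCoeff]
  have h2 : modeSlope n l * modeRoot n l = (modeSlope n l *
      (3 * ringCoeff n l - 5 * ringCoeff n 1 - (ringCoeff n (l + 1) + ringCoeff n (l - 1)) / 2) +
      ((ringCoeff n (l + 1) - ringCoeff n (l - 1)) / 2) ^ 2) / 6 := by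
    rw [modeRoot]; field_simp
  rw [mul_sub, mul_assoc (3 / 2 : ℝ) _ (modeRoot n l), h2, modeDet, e1, e2, e3]
  have e4 : ∀ k : ℕ, ringSum (k : ZMod n) = ringCoeff n k := fun _ => rfl
  simp only [e4, modeSlope]
  ring

theorem modeDet_eq_zero_iff {l : ℕ} (h1 : 1 ≤ l) (hl : 2 * l ≤ n) {m : ℝ} :
    modeDet n l m = 0 ↔ m = modeRoot n l := by
  have hW := modeSlope_pos (n := n) h1 hl
  rw [modeDet_eq h1 hl, mul_eq_zero, sub_eq_zero]
  simp [hW.ne']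

/-- Let D_l = S_{l+1} - S_l. Apart from its quotient term, 6 `modeRoot n l` equals 2S_l - 5S_1 -
C_l/2, which grows by more than 2D_l because C_l decreases. The quotient is q²/W with 0 < q < W,
hence less than q = D_l - C_l/2 ≤ 2D_l; this last step is what the second half of
`ringCoeff_diff_pos` is for. At l + 1 the quotient is merely nonnegative. -/
theorem modeRoot_lt_succ {l : ℕ} (h1 : 1 ≤ l) (hl : 2 * (l + 1) ≤ n) :
    modeRoot n l < modeRoot n (l + 1) := by
  obtain ⟨k, rfl⟩ : ∃ k, l = k + 1 := ⟨l - 1, by omega⟩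
  have hS := ringCoeff_one_pos (n := n) (by omega)
  have hW := modeSlope_pos (n := n) (l := k + 1) (by omega) (by omega)
  have hW' := modeSlope_pos (n := n) (l := k + 2) (by omega) (by omega)
  obtain ⟨hD, hE⟩ := ringCoeff_diff_pos (n := n) (l := k + 1) (by omega)
  have hD' := (ringCoeff_diff_pos (n := n) (l := k) (by omega)).1
  have hrec := ringCoeff_add_two (n := n) k
  have hrec' := ringCoeff_add_two (n := n) (k + 1)
  have hc := ringCos_sub_succ (n := n) (l := k + 1) (by omega)
  have hcpos := cot_halfAngle_pos (n := n) (l := k + 1) (by omega)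
  have hC := ringCoeff_one_le (n := n) (l := k + 1) (by omega) (by omega)
  have hC0 := ringCoeff_nonneg (n := n) k
  have hR : 0 ≤ ((ringCoeff n (k + 3) - ringCoeff n (k + 1)) / 2) ^ 2 / modeSlope n (k + 2) := by
    positivity
  have hR' : ((ringCoeff n (k + 2) - ringCoeff n k) / 2) ^ 2 / modeSlope n (k + 1) <
      2 * (ringCoeff n (k + 2) - ringCoeff n (k + 1)) := by
    have hq : (ringCoeff n (k + 2) - ringCoeff n k) / 2 < modeSlope n (k + 1) := by
      simp only [modeSlope, Nat.add_sub_cancel, add_assoc, Nat.reduceAdd]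
      linarith
    rw [div_lt_iff₀ hW]
    nlinarith
  simp only [modeRoot, Nat.add_sub_cancel, add_assoc, Nat.reduceAdd] at *
  have e : k + 2 - 1 = k + 1 := by omega
  rw [e]
  linarith

theorem modeRoot_strictMono {l j : ℕ} (h1 : 1 ≤ l) (hlj : l < j) (hj : 2 * j ≤ n) :
    modeRoot n l < modeRoot n j := by
  induction j, hlj using Nat.le_induction with
  | base => exact modeRoot_lt_succ h1 hj
  | succ j h ih => exact (ih (by omega)).trans (modeRoot_lt_succ (by omega) hj)

/-- Since C_0 = 2S_1, the recursion expresses each low coefficient by S_1 and finitely many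
cotangents, the only quantities that need numerical bounds. -/
theorem ringCoeff_two (hn : 1 < n) :
    ringCoeff n 2 = 4 * ringCoeff n 1 - Real.cot (halfAngle n 0) := by
  have h1 := ringCoeff_add_two (n := n) 0
  have h2 := ringCos_sub_succ (n := n) (l := 0) (by omega)
  rw [ringCos_zero] at h2
  rw [ringCoeff_zero] at h1
  simp only [zero_add] at h1 h2
  linarith

theorem ringCoeff_three (hn : 2 < n) : ringCoeff n 3 =
    9 * ringCoeff n 1 - 3 * Real.cot (halfAngle n 0) - Real.cot (halfAngle n 1) := by
  have h1 := ringCoeff_add_two (n := n) 1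
  have h2 := ringCos_sub_succ (n := n) (l := 0) (by omega)
  have h3 := ringCos_sub_succ (n := n) (l := 1) (by omega)
  rw [ringCos_zero] at h2
  norm_num at h1 h2 h3
  linarith [ringCoeff_two (n := n) (by omega)]

theorem ringCoeff_four (hn : 3 < n) : ringCoeff n 4 =
    16 * ringCoeff n 1 - 6 * Real.cot (halfAngle n 0) - 3 * Real.cot (halfAngle n 1) -
      Real.cot (halfAngle n 2) := by
  have h1 := ringCoeff_add_two (n := n) 2
  have h2 := ringCos_sub_succ (n := n) (l := 0) (by omega)
  have h3 := ringCos_sub_succ (n := n) (l := 1) (by omega)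
  have h4 := ringCos_sub_succ (n := n) (l := 2) (by omega)
  rw [ringCos_zero] at h2
  norm_num at h1 h2 h3 h4
  linarith [ringCoeff_two (n := n) (by omega), ringCoeff_three (n := n) (by omega)]

theorem modeRoot_two_pos_iff (hn : 4 ≤ n) : 0 < modeRoot n 2 ↔
    0 < 16 * ringCoeff n 1 ^ 2 - 15 * ringCoeff n 1 * Real.cot (halfAngle n 0) +
      3 * Real.cot (halfAngle n 0) ^ 2 + ringCoeff n 1 * Real.cot (halfAngle n 1) := by
  have hW := modeSlope_pos (n := n) (l := 2) (by omega) (by omega)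
  have h : 2 * (modeSlope n 2 * modeRoot n 2) =
      16 * ringCoeff n 1 ^ 2 - 15 * ringCoeff n 1 * Real.cot (halfAngle n 0) +
      3 * Real.cot (halfAngle n 0) ^ 2 + ringCoeff n 1 * Real.cot (halfAngle n 1) := by
    have h1 : modeSlope n 2 * modeRoot n 2 = (modeSlope n 2 *
      (3 * ringCoeff n 2 - 5 * ringCoeff n 1 - (ringCoeff n (2 + 1) + ringCoeff n (2 - 1)) / 2) +
      ((ringCoeff n (2 + 1) - ringCoeff n (2 - 1)) / 2) ^ 2) / 6 := by
      rw [modeRoot]; field_simp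
    rw [h1]
    simp only [modeSlope, Nat.reduceAdd, Nat.reduceSub]
    rw [ringCoeff_two (by omega), ringCoeff_three (by omega)]
    ring
  rw [← h]
  constructor
  · intro h0; positivity
  · intro h0
    exact pos_of_mul_pos_right (by linarith) hW.le

/-- The hypothesis is 6 `modeRoot n 3` with its nonnegative quotient term dropped. -/
theorem modeRoot_three_pos (hn : 6 ≤ n) (h : 0 < 12 * ringCoeff n 1 -
      11 / 2 * Real.cot (halfAngle n 0) - 3 / 2 * Real.cot (halfAngle n 1) +
      1 / 2 * Real.cot (halfAngle n 2)) : 0 < modeRoot n 3 := by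
  have hW := modeSlope_pos (n := n) (l := 3) (by omega) (by omega)
  have hR : 0 ≤ ((ringCoeff n (3 + 1) - ringCoeff n (3 - 1)) / 2) ^ 2 / modeSlope n 3 := by
    positivity
  rw [modeRoot]
  simp only [Nat.reduceAdd, Nat.reduceSub] at *
  rw [ringCoeff_three (by omega), ringCoeff_four (by omega), ringCoeff_two (by omega)] at *
  linarith

/-- The m² terms cancel again. As the constant term is positive, a positive root exists exactly when
the slope is negative. -/
theorem firstModeDet_eq (hn : 1 < n) (m : ℝ) : firstModeDet n m =
    3 / 4 * (8 * ringCoeff n 1 - Real.cot (halfAngle n 0) - 2 * n) * m +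
      (3 * ringCoeff n 1 - Real.cot (halfAngle n 0) / 2) * (n / 2 + ringCoeff n 1) := by
  have e1 : ringSum (1 : ZMod n) = ringCoeff n 1 := by simp [ringCoeff]
  have e2 : ringSum (2 : ZMod n) = ringCoeff n 2 := by simp [ringCoeff]
  rw [firstModeDet, e1, e2, ringCoeff_two hn]
  ring

theorem firstModeDet_const_pos (hn : 1 < n) :
    0 < (3 * ringCoeff n 1 - Real.cot (halfAngle n 0) / 2) * (n / 2 + ringCoeff n 1) := by
  have hS := ringCoeff_one_pos (n := n) (by omega)
  have h2 := ringCoeff_nonneg (n := n) 2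
  rw [ringCoeff_two hn] at h2
  refine mul_pos (by linarith) (by positivity)

end

/-! ### Taylor enclosures of sine, cosecant and cotangent. -/

theorem nonneg_of_hasDerivAt {f f' : ℝ → ℝ} (hf : ∀ x, HasDerivAt f (f' x) x) (h0 : f 0 = 0)
    (hf' : ∀ x, 0 ≤ x → 0 ≤ f' x) {x : ℝ} (hx : 0 ≤ x) : 0 ≤ f x := by
  have h : MonotoneOn f (Set.Ici 0) := by
    refine monotoneOn_of_hasDerivWithinAt_nonneg (f' := f') (convex_Ici 0)
      (fun y _ => (hf y).continuousAt.continuousWithinAt) (fun y _ => (hf y).hasDerivWithinAt) ?_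
    intro y hy
    rw [interior_Ici] at hy
    exact hf' y (le_of_lt hy)
  simpa [h0] using h Set.self_mem_Ici hx hx

/-- Each Taylor bound from here to `sin_le_sinTaylor_add` is the previous one integrated from 0. -/
theorem cos_le_taylor_four {x : ℝ} (hx : 0 ≤ x) : Real.cos x ≤ 1 - x ^ 2 / 2 + x ^ 4 / 24 := by
  have h := nonneg_of_hasDerivAt (f := fun x => 1 - x ^ 2 / 2 + x ^ 4 / 24 - Real.cos x)
    (f' := fun x => Real.sin x - (x - x ^ 3 / 6)) (fun x => ?_) (by simp) (fun x hx => ?_) hx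
  · linarith
  · have := (((((hasDerivAt_id x).pow 2).div_const 2).const_sub 1).add
      (((hasDerivAt_id x).pow 4).div_const 24)).sub (Real.hasDerivAt_cos x)
    refine this.congr_deriv ?_
    simp
    ring
  · linarith [Real.sin_ge_sub_cube hx]

theorem sin_le_taylor_five {x : ℝ} (hx : 0 ≤ x) : Real.sin x ≤ x - x ^ 3 / 6 + x ^ 5 / 120 := by
  have h := nonneg_of_hasDerivAt (f := fun x => x - x ^ 3 / 6 + x ^ 5 / 120 - Real.sin x)
    (f' := fun x => 1 - x ^ 2 / 2 + x ^ 4 / 24 - Real.cos x) (fun x => ?_) (by simp)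
    (fun x hx => by linarith [cos_le_taylor_four hx]) hx
  · linarith
  · have := (((hasDerivAt_id x).sub (((hasDerivAt_id x).pow 3).div_const 6)).add
      (((hasDerivAt_id x).pow 5).div_const 120)).sub (Real.hasDerivAt_sin x)
    refine this.congr_deriv ?_
    simp
    ring

theorem taylor_six_le_cos {x : ℝ} (hx : 0 ≤ x) :
    1 - x ^ 2 / 2 + x ^ 4 / 24 - x ^ 6 / 720 ≤ Real.cos x := by
  have h := nonneg_of_hasDerivAt
    (f := fun x => Real.cos x - (1 - x ^ 2 / 2 + x ^ 4 / 24 - x ^ 6 / 720))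
    (f' := fun x => x - x ^ 3 / 6 + x ^ 5 / 120 - Real.sin x) (fun x => ?_) (by simp)
    (fun x hx => by linarith [sin_le_taylor_five hx]) hx
  · linarith
  · have := (Real.hasDerivAt_cos x).sub (((((hasDerivAt_id x).pow 2).div_const 2).const_sub 1).add
      (((hasDerivAt_id x).pow 4).div_const 24) |>.sub (((hasDerivAt_id x).pow 6).div_const 720))
    refine this.congr_deriv ?_
    simp
    ring

/-- The Taylor polynomial of degree seven of the sine. -/
noncomputable def sinTaylor (x : ℝ) : ℝ := x - x ^ 3 / 6 + x ^ 5 / 120 - x ^ 7 / 5040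

theorem sinTaylor_le_sin {x : ℝ} (hx : 0 ≤ x) : sinTaylor x ≤ Real.sin x := by
  have h := nonneg_of_hasDerivAt
    (f := fun x => Real.sin x - (x - x ^ 3 / 6 + x ^ 5 / 120 - x ^ 7 / 5040))
    (f' := fun x => Real.cos x - (1 - x ^ 2 / 2 + x ^ 4 / 24 - x ^ 6 / 720)) (fun x => ?_) (by simp)
    (fun x hx => by linarith [taylor_six_le_cos hx]) hx
  · rw [sinTaylor]; linarith
  · have := (Real.hasDerivAt_sin x).sub ((((hasDerivAt_id x).sub
      (((hasDerivAt_id x).pow 3).div_const 6)).add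
      (((hasDerivAt_id x).pow 5).div_const 120)).sub (((hasDerivAt_id x).pow 7).div_const 5040))
    refine this.congr_deriv ?_
    simp
    ring

theorem cos_le_taylor_eight {x : ℝ} (hx : 0 ≤ x) :
    Real.cos x ≤ 1 - x ^ 2 / 2 + x ^ 4 / 24 - x ^ 6 / 720 + x ^ 8 / 40320 := by
  have h := nonneg_of_hasDerivAt
    (f := fun x => 1 - x ^ 2 / 2 + x ^ 4 / 24 - x ^ 6 / 720 + x ^ 8 / 40320 - Real.cos x)
    (f' := fun x => Real.sin x - sinTaylor x) (fun x => ?_) (by simp)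
    (fun x hx => by linarith [sinTaylor_le_sin hx]) hx
  · linarith
  · have := ((((((hasDerivAt_id x).pow 2).div_const 2).const_sub 1).add
      (((hasDerivAt_id x).pow 4).div_const 24) |>.sub (((hasDerivAt_id x).pow 6).div_const 720)).add
      (((hasDerivAt_id x).pow 8).div_const 40320)).sub (Real.hasDerivAt_cos x)
    refine this.congr_deriv ?_
    simp [sinTaylor]
    ring

theorem sin_le_sinTaylor_add {x : ℝ} (hx : 0 ≤ x) :
    Real.sin x ≤ sinTaylor x + x ^ 9 / 362880 := by
  have h := nonneg_of_hasDerivAt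
    (f := fun x => x - x ^ 3 / 6 + x ^ 5 / 120 - x ^ 7 / 5040 + x ^ 9 / 362880 - Real.sin x)
    (f' := fun x => 1 - x ^ 2 / 2 + x ^ 4 / 24 - x ^ 6 / 720 + x ^ 8 / 40320 - Real.cos x)
    (fun x => ?_) (by simp) (fun x hx => by linarith [cos_le_taylor_eight hx]) hx
  · rw [sinTaylor]; linarith
  · have := (((((hasDerivAt_id x).sub
      (((hasDerivAt_id x).pow 3).div_const 6)).add
      (((hasDerivAt_id x).pow 5).div_const 120)).sub
      (((hasDerivAt_id x).pow 7).div_const 5040)).add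
      (((hasDerivAt_id x).pow 9).div_const 362880)).sub (Real.hasDerivAt_sin x)
    refine this.congr_deriv ?_
    simp
    ring

/-- The cutoff 49/100 keeps 3.141593 r below π/2, where the sine is increasing and π may be replaced
by decimal bounds. -/
theorem sin_pi_mul_bounds {r : ℝ} (h0 : 0 ≤ r) (h1 : r ≤ 49 / 100) :
    sinTaylor (3.141592 * r) ≤ Real.sin (Real.pi * r) ∧ Real.sin (Real.pi * r) ≤
      sinTaylor (3.141593 * r) + (3.141593 * r) ^ 9 / 362880 := by
  have hp := Real.pi_gt_d6
  have hp' := Real.pi_lt_d6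
  constructor
  · exact (sinTaylor_le_sin (by positivity)).trans (Real.sin_le_sin_of_le_of_le_pi_div_two
      (by nlinarith) (by nlinarith) (by nlinarith))
  · exact (Real.sin_le_sin_of_le_of_le_pi_div_two (by nlinarith) (by nlinarith)
      (by nlinarith)).trans (sin_le_sinTaylor_add (by positivity))

/-- The cosecant of `π s / n`. -/
noncomputable def ringCsc (n s : ℕ) : ℝ := (Real.sin (Real.pi * (s / n)))⁻¹

theorem ringCsc_bounds {n s : ℕ} {lo hi : ℝ} (h1 : (s : ℝ) / n ≤ 49 / 100)
    (hl : 0 < sinTaylor (3.141592 * (s / n)))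
    (hlo : lo * (sinTaylor (3.141593 * (s / n)) + (3.141593 * (s / n)) ^ 9 / 362880) ≤ 1)
    (hhi : 1 ≤ hi * sinTaylor (3.141592 * (s / n))) :
    lo ≤ ringCsc n s ∧ ringCsc n s ≤ hi := by
  obtain ⟨h2, h3⟩ := sin_pi_mul_bounds (r := (s : ℝ) / n) (by positivity) h1
  have h4 : 0 < Real.sin (Real.pi * (s / n)) := hl.trans_le h2
  rw [ringCsc]
  have h5 : 0 ≤ hi := by
    by_contra h
    nlinarith
  constructor
  · rw [inv_eq_one_div, le_div_iff₀ h4]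
    rcases le_total lo 0 with h | h
    · nlinarith
    · exact (mul_le_mul_of_nonneg_left h3 h).trans hlo
  · rw [inv_eq_one_div, div_le_iff₀ h4]
    exact hhi.trans (mul_le_mul_of_nonneg_left h2 h5)

/-- The cosine is read as the sine of the complementary angle πr', so all hypotheses are rational
inequalities. -/
theorem cot_bounds {n l : ℕ} {r r' lo hi : ℝ} (hn : 0 < n) (hr : r = (2 * l + 1) / (2 * n))
    (hr' : r' = 1 / 2 - r) (h0 : 0 ≤ r') (h1 : r' ≤ 49 / 100) (h2 : r ≤ 49 / 100)
    (hl : 0 < sinTaylor (3.141592 * r)) (hlo0 : 0 ≤ lo) (hhi0 : 0 ≤ hi)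
    (hlo : lo * (sinTaylor (3.141593 * r) + (3.141593 * r) ^ 9 / 362880) ≤
      sinTaylor (3.141592 * r'))
    (hhi : sinTaylor (3.141593 * r') + (3.141593 * r') ^ 9 / 362880 ≤
      hi * sinTaylor (3.141592 * r)) :
    lo ≤ Real.cot (halfAngle n l) ∧ Real.cot (halfAngle n l) ≤ hi := by
  have hn' : (n : ℝ) ≠ 0 := by exact_mod_cast hn.ne'
  obtain ⟨h3, h4⟩ := sin_pi_mul_bounds (r := r) (by rw [hr]; positivity) h2
  obtain ⟨h5, h6⟩ := sin_pi_mul_bounds (r := r') h0 h1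
  have e1 : halfAngle n l = Real.pi * r := by rw [halfAngle, hr]; field_simp
  have e2 : Real.cos (Real.pi * r) = Real.sin (Real.pi * r') := by
    rw [← Real.sin_pi_div_two_sub, hr']; congr 1; ring
  have h7 : 0 < Real.sin (Real.pi * r) := hl.trans_le h3
  rw [Real.cot_eq_cos_div_sin, e1, e2, le_div_iff₀ h7, div_le_iff₀ h7]
  constructor
  · nlinarith
  · nlinarith

theorem ringCsc_sub {n s : ℕ} (hn : 0 < n) (hs : s ≤ n) : ringCsc n (n - s) = ringCsc n s := by
  have hn' : (n : ℝ) ≠ 0 := by exact_mod_cast hn.ne'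
  rw [ringCsc, ringCsc, ← Real.sin_pi_sub, Nat.cast_sub hs]
  congr 2
  field_simp
  ring

theorem ringCsc_zero (n : ℕ) : ringCsc n 0 = 0 := by simp [ringCsc]

theorem ringCsc_half {n : ℕ} (hn : 0 < n) : ringCsc (2 * n) n = 1 := by
  have hn' : (n : ℝ) ≠ 0 := by exact_mod_cast hn.ne'
  have : Real.pi * ((n : ℝ) / (2 * n : ℕ)) = Real.pi / 2 := by push_cast; field_simp
  rw [ringCsc, this, Real.sin_pi_div_two, inv_one]

theorem ringCsc_nonneg {n s : ℕ} (hs : s ≤ n) : 0 ≤ ringCsc n s := by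
  have h : (s : ℝ) / n ≤ 1 := div_le_one_of_le₀ (by exact_mod_cast hs) (by positivity)
  exact inv_nonneg.2 (Real.sin_nonneg_of_nonneg_of_le_pi (by positivity)
    (by nlinarith [Real.pi_pos]))

theorem div_le_ringCsc {n s : ℕ} (h0 : 0 < s) (hs : s < n) : n / (Real.pi * s) ≤ ringCsc n s := by
  have hn : (0 : ℝ) < n := by exact_mod_cast (by omega : 0 < n)
  have h1 : (0 : ℝ) < s := by exact_mod_cast h0
  have h2 : (s : ℝ) / n < 1 := by
    rw [div_lt_one hn]; exact_mod_cast hs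
  have h3 : 0 < Real.sin (Real.pi * (s / n)) := Real.sin_pos_of_pos_of_lt_pi (by positivity)
    (by nlinarith [Real.pi_pos])
  rw [ringCsc, ← inv_div, mul_div_assoc]
  exact inv_anti₀ h3 (Real.sin_le (by positivity))

/-- For n ≥ 13 the indices 1, …, 6 and their reflections are disjoint. -/
theorem two_mul_sum_le_sum_range {n : ℕ} (hn : 13 ≤ n) {f : ℕ → ℝ} (h0 : ∀ s ≤ n, 0 ≤ f s)
    (hf : ∀ s ≤ n, f (n - s) = f s) :
    2 * (f 1 + f 2 + f 3 + f 4 + f 5 + f 6) ≤ ∑ s ∈ Finset.range n, f s := by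
  obtain ⟨k, rfl⟩ : ∃ k, n = k + 13 := ⟨n - 13, by omega⟩
  have h1 : ∑ s ∈ Finset.range 7, f s ≤ ∑ s ∈ Finset.range (k + 7), f s :=
    Finset.sum_le_sum_of_subset_of_nonneg (by simp)
      (fun s hs _ => h0 s (by have := Finset.mem_range.1 hs; omega))
  have h2 : ∑ s ∈ Finset.range (k + 13), f s = ∑ s ∈ Finset.range (k + 7), f s + f (k + 7) +
      f (k + 8) + f (k + 9) + f (k + 10) + f (k + 11) + f (k + 12) := by
    simp only [Finset.sum_range_succ]
  have e1 : f (k + 12) = f 1 := hf 1 (by omega)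
  have e2 : f (k + 11) = f 2 := hf 2 (by omega)
  have e3 : f (k + 10) = f 3 := hf 3 (by omega)
  have e4 : f (k + 9) = f 4 := hf 4 (by omega)
  have e5 : f (k + 8) = f 5 := hf 5 (by omega)
  have e6 : f (k + 7) = f 6 := hf 6 (by omega)
  have h3 : ∑ s ∈ Finset.range 7, f s = f 0 + f 1 + f 2 + f 3 + f 4 + f 5 + f 6 := by
    simp only [Finset.sum_range_succ, Finset.sum_range_zero, zero_add]
  linarith [h0 0 (by omega)]

theorem ringCoeff_one_eq {n : ℕ} [NeZero n] :
    ringCoeff n 1 = (∑ s ∈ Finset.range n, ringCsc n s) / 4 := by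
  rw [ringCoeff, Nat.cast_one, ringSum_one, ringCos, Finset.sum_div, Finset.sum_div]
  refine Finset.sum_congr rfl fun s _ => ?_
  simp [ringCsc, mul_div_assoc]
  ring

/-! ### Signs of the decisive quantities, n by n. -/

/-- Twice the product of `modeSlope` and `modeRoot` for the second mode. -/
noncomputable def secondModeForm (n : ℕ) [NeZero n] : ℝ :=
  16 * ringCoeff n 1 ^ 2 - 15 * ringCoeff n 1 * Real.cot (halfAngle n 0) +
    3 * Real.cot (halfAngle n 0) ^ 2 + ringCoeff n 1 * Real.cot (halfAngle n 1)

theorem secondModeForm_nonpos {n : ℕ} [NeZero n] {a b p q r : ℝ} (ha : 0 ≤ a)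
    (h1 : a ≤ ringCoeff n 1) (h2 : ringCoeff n 1 ≤ b) (hp : 0 ≤ p)
    (h3 : p ≤ Real.cot (halfAngle n 0)) (h4 : Real.cot (halfAngle n 0) ≤ q) (hr : 0 ≤ r)
    (h5 : Real.cot (halfAngle n 1) ≤ r) (h : 16 * b ^ 2 - 15 * a * p + 3 * q ^ 2 + b * r ≤ 0) :
    secondModeForm n ≤ 0 := by
  have e1 : ringCoeff n 1 ^ 2 ≤ b ^ 2 := pow_le_pow_left₀ (ha.trans h1) h2 2
  have e2 : a * p ≤ ringCoeff n 1 * Real.cot (halfAngle n 0) :=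
    mul_le_mul h1 h3 hp (ha.trans h1)
  have e3 : Real.cot (halfAngle n 0) ^ 2 ≤ q ^ 2 := pow_le_pow_left₀ (hp.trans h3) h4 2
  have e4 : ringCoeff n 1 * Real.cot (halfAngle n 1) ≤ b * r :=
    (mul_le_mul_of_nonneg_left h5 (ha.trans h1)).trans (mul_le_mul_of_nonneg_right h2 hr)
  rw [secondModeForm]
  linarith

theorem secondModeForm_pos {n : ℕ} [NeZero n] {a b p q r : ℝ} (ha : 0 ≤ a)
    (h1 : a ≤ ringCoeff n 1) (h2 : ringCoeff n 1 ≤ b) (hp : 0 ≤ p)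
    (h3 : p ≤ Real.cot (halfAngle n 0)) (h4 : Real.cot (halfAngle n 0) ≤ q) (hr : 0 ≤ r)
    (h5 : r ≤ Real.cot (halfAngle n 1)) (h : 0 < 16 * a ^ 2 - 15 * b * q + 3 * p ^ 2 + a * r) :
    0 < secondModeForm n := by
  have e1 : a ^ 2 ≤ ringCoeff n 1 ^ 2 := pow_le_pow_left₀ ha h1 2
  have e2 : ringCoeff n 1 * Real.cot (halfAngle n 0) ≤ b * q :=
    mul_le_mul h2 h4 (hp.trans h3) (ha.trans (h1.trans h2))
  have e3 : p ^ 2 ≤ Real.cot (halfAngle n 0) ^ 2 := pow_le_pow_left₀ hp h3 2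
  have e4 : a * r ≤ ringCoeff n 1 * Real.cot (halfAngle n 1) :=
    mul_le_mul h1 h5 hr (ha.trans h1)
  rw [secondModeForm]
  linarith

/-- Everything is compared with 1/x for x = π/(2n): both cotangents are controlled by one-term
estimates, while S_1 is bounded below by six reciprocal terms. -/
theorem large_ring_estimates {n : ℕ} [NeZero n] (hn : 13 ≤ n) :
    Real.cot (halfAngle n 0) + 2 * n < 8 * ringCoeff n 1 ∧ 0 < secondModeForm n := by
  have hn' : (13 : ℝ) ≤ n := by exact_mod_cast hn
  have hp := Real.pi_gt_d6
  have hp' := Real.pi_lt_d6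
  set x : ℝ := halfAngle n 0 with hx
  have hxe : x = Real.pi / (2 * n) := by rw [hx, halfAngle]; norm_num
  have hx0 : 0 < x := by rw [hxe]; positivity
  have hxn : 2 * n * x = Real.pi := by rw [hxe]; field_simp
  have hx1 : x ≤ 121 / 1000 := by nlinarith
  have h3x : halfAngle n 1 = 3 * x := by rw [hxe, halfAngle]; field_simp; norm_num
  have cot_le : ∀ y, 0 < y → y < 1 → Real.cot y ≤ 1 / y := by
    intro y h0 h1
    have h2 : 0 < Real.cos y := Real.cos_pos_of_mem_Ioo ⟨by linarith, by linarith⟩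
    have h3 := Real.lt_tan h0 (by linarith)
    have h4 := (one_div_lt_one_div_of_lt h0 h3).le
    rwa [Real.tan_eq_sin_div_cos, one_div_div, ← Real.cot_eq_cos_div_sin] at h4
  have le_cot : ∀ y, 0 < y → y < 1 → (1 - y ^ 2 / 2) / y ≤ Real.cot y := by
    intro y h0 h1
    have h2 : 0 < Real.sin y := Real.sin_pos_of_pos_of_lt_pi h0 (by linarith)
    rw [Real.cot_eq_cos_div_sin]
    exact div_le_div₀ (by nlinarith [Real.one_sub_sq_div_two_le_cos (x := y)])
      Real.one_sub_sq_div_two_le_cos h2 (Real.sin_le h0.le)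
  -- The constant is H_6/4, with H_6 = 1 + 1/2 + … + 1/6 = 2.45.
  have hS : 6125 / 10000 * (1 / x) ≤ ringCoeff n 1 := by
    have h1 := two_mul_sum_le_sum_range hn (f := ringCsc n) (fun s hs => ringCsc_nonneg hs)
      (fun s hs => ringCsc_sub (by omega) hs)
    have h2 : ∀ s : ℕ, 0 < s → s < n → 1 / x * (1 / (2 * s)) ≤ ringCsc n s := by
      intro s h0 h1
      have h3 := div_le_ringCsc h0 h1
      have h4 : (0 : ℝ) < s := by exact_mod_cast h0
      have e : 1 / x * (1 / (2 * s)) = n / (Real.pi * s) := by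
        rw [hxe]; field_simp
      rwa [e]
    have k1 := h2 1 (by omega) (by omega)
    have k2 := h2 2 (by omega) (by omega)
    have k3 := h2 3 (by omega) (by omega)
    have k4 := h2 4 (by omega) (by omega)
    have k5 := h2 5 (by omega) (by omega)
    have k6 := h2 6 (by omega) (by omega)
    norm_num at k1 k2 k3 k4 k5 k6 ⊢
    rw [ringCoeff_one_eq]
    linarith
  have hc0 := cot_le x hx0 (by linarith)
  have hc0' := le_cot x hx0 (by linarith)
  have hc1 := le_cot (3 * x) (by linarith) (by linarith)
  rw [secondModeForm, h3x]
  generalize Real.cot (3 * x) = c1 at *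
  have hy : 1 / x * x = 1 := by field_simp
  have e1 : (1 - x ^ 2 / 2) / x = 1 / x - x / 2 := by field_simp
  have e2 : (1 - (3 * x) ^ 2 / 2) / (3 * x) = 1 / 3 * (1 / x) - 3 / 2 * x := by field_simp
  rw [e1] at hc0'
  rw [e2] at hc1
  have hn2 : 2 * n = Real.pi * (1 / x) := by rw [← hxn]; field_simp
  generalize 1 / x = y at *
  generalize ringCoeff n 1 = S at *
  -- From x ≤ 0.121 and xy = 1. It makes the correction 3x/2 in the second cotangent small enough to
  -- leave 0.311 y.
  have hxy : x ≤ 1465 / 100000 * y := by nlinarith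
  have hc1' : 311 / 1000 * y ≤ c1 := by linarith
  have hy0 : 0 < y := by nlinarith
  generalize Real.cot x = c at *
  refine ⟨by rw [hn2]; nlinarith, ?_⟩
  have hS0 : 6125 / 10000 * c ≤ S := by linarith
  have hc : 0 < c := by linarith
  have hSp : 0 < S := by linarith
  have h1 : 311 / 1000 * c * S ≤ S * c1 := by nlinarith
  -- The product expands to 16S² - 14.689 Sc + 2.9945125 c², where 14.689 = 15 - 0.311; the surplus
  -- up to 3c² makes the result strict.
  have h2 : 0 ≤ (S - 6125 / 10000 * c) * (16 * S - 4889 / 1000 * c) :=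
    mul_nonneg (by linarith) (by linarith)
  nlinarith [mul_pos hc hc]

theorem ring_estimates_three : 8 * ringCoeff 3 1 < Real.cot (halfAngle 3 0) + 2 * 3 := by
  have e2 : ringCsc 3 2 = ringCsc 3 1 :=
    ringCsc_sub (n := 3) (s := 1) (by norm_num) (by norm_num)
  have hS := ringCoeff_one_eq (n := 3)
  simp only [Finset.sum_range_succ, Finset.sum_range_zero, ringCsc_zero, e2] at hS
  obtain ⟨l1, u1⟩ := ringCsc_bounds (n := 3) (s := 1) (lo := 1.15470) (hi := 1.15471)
    (by norm_num) (by norm_num [sinTaylor]) (by norm_num [sinTaylor]) (by norm_num [sinTaylor])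
  obtain ⟨p0, q0⟩ := cot_bounds (n := 3) (l := 0) (lo := 1.73204) (hi := 1.73206)
    (by norm_num) rfl rfl (by norm_num) (by norm_num) (by norm_num) (by norm_num [sinTaylor])
    (by norm_num) (by norm_num) (by norm_num [sinTaylor]) (by norm_num [sinTaylor])
  norm_num at hS
  linarith

theorem ring_estimates_four : 8 * ringCoeff 4 1 < Real.cot (halfAngle 4 0) + 2 * 4 ∧
    secondModeForm 4 ≤ 0 := by
  have e3 : ringCsc 4 3 = ringCsc 4 1 :=
    ringCsc_sub (n := 4) (s := 1) (by norm_num) (by norm_num)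
  have e2 : ringCsc 4 2 = 1 := ringCsc_half (n := 2) (by norm_num)
  have hS := ringCoeff_one_eq (n := 4)
  simp only [Finset.sum_range_succ, Finset.sum_range_zero, ringCsc_zero, e3, e2] at hS
  obtain ⟨l1, u1⟩ := ringCsc_bounds (n := 4) (s := 1) (lo := 1.41421) (hi := 1.41422)
    (by norm_num) (by norm_num [sinTaylor]) (by norm_num [sinTaylor]) (by norm_num [sinTaylor])
  obtain ⟨p0, q0⟩ := cot_bounds (n := 4) (l := 0) (lo := 2.41418) (hi := 2.41422)
    (by norm_num) rfl rfl (by norm_num) (by norm_num) (by norm_num) (by norm_num [sinTaylor])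
    (by norm_num) (by norm_num) (by norm_num [sinTaylor]) (by norm_num [sinTaylor])
  obtain ⟨p1, q1⟩ := cot_bounds (n := 4) (l := 1) (lo := 0.41421) (hi := 0.41422)
    (by norm_num) rfl rfl (by norm_num) (by norm_num) (by norm_num) (by norm_num [sinTaylor])
    (by norm_num) (by norm_num) (by norm_num [sinTaylor]) (by norm_num [sinTaylor])
  exact ⟨by linarith, secondModeForm_nonpos (a := 0.95710) (b := 0.95711) (p := 2.41418) (q := 2.41422) (r := 0.41422) (by norm_num)
    (by linarith) (by linarith) (by norm_num) p0 q0 (by norm_num) q1 (by norm_num)⟩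

theorem ring_estimates_five : 8 * ringCoeff 5 1 < Real.cot (halfAngle 5 0) + 2 * 5 ∧
    secondModeForm 5 ≤ 0 := by
  have e4 : ringCsc 5 4 = ringCsc 5 1 :=
    ringCsc_sub (n := 5) (s := 1) (by norm_num) (by norm_num)
  have e3 : ringCsc 5 3 = ringCsc 5 2 :=
    ringCsc_sub (n := 5) (s := 2) (by norm_num) (by norm_num)
  have hS := ringCoeff_one_eq (n := 5)
  simp only [Finset.sum_range_succ, Finset.sum_range_zero, ringCsc_zero, e4, e3] at hS
  obtain ⟨l1, u1⟩ := ringCsc_bounds (n := 5) (s := 1) (lo := 1.70130) (hi := 1.70131)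
    (by norm_num) (by norm_num [sinTaylor]) (by norm_num [sinTaylor]) (by norm_num [sinTaylor])
  obtain ⟨l2, u2⟩ := ringCsc_bounds (n := 5) (s := 2) (lo := 1.05146) (hi := 1.05149)
    (by norm_num) (by norm_num [sinTaylor]) (by norm_num [sinTaylor]) (by norm_num [sinTaylor])
  obtain ⟨p0, q0⟩ := cot_bounds (n := 5) (l := 0) (lo := 3.07761) (hi := 3.07769)
    (by norm_num) rfl rfl (by norm_num) (by norm_num) (by norm_num) (by norm_num [sinTaylor])
    (by norm_num) (by norm_num) (by norm_num [sinTaylor]) (by norm_num [sinTaylor])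
  obtain ⟨p1, q1⟩ := cot_bounds (n := 5) (l := 1) (lo := 0.72654) (hi := 0.72655)
    (by norm_num) rfl rfl (by norm_num) (by norm_num) (by norm_num) (by norm_num [sinTaylor])
    (by norm_num) (by norm_num) (by norm_num [sinTaylor]) (by norm_num [sinTaylor])
  exact ⟨by linarith, secondModeForm_nonpos (a := 1.37638) (b := 1.37640) (p := 3.07761) (q := 3.07769) (r := 0.72655) (by norm_num)
    (by linarith) (by linarith) (by norm_num) p0 q0 (by norm_num) q1 (by norm_num)⟩

/-- Only for n = 6 do the first mode and a higher mode both contribute. The last three bounds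
separate their roots: `modeRoot 6 3` is below 1, and on (0, 1) `firstModeDet` stays positive. -/
theorem ring_estimates_six : 8 * ringCoeff 6 1 < Real.cot (halfAngle 6 0) + 2 * 6 ∧
    secondModeForm 6 ≤ 0 ∧ 0 < 12 * ringCoeff 6 1 -
      11 / 2 * Real.cot (halfAngle 6 0) - 3 / 2 * Real.cot (halfAngle 6 1) +
      1 / 2 * Real.cot (halfAngle 6 2) ∧
    12 * ringCoeff 6 1 -
      11 / 2 * Real.cot (halfAngle 6 0) - 3 / 2 * Real.cot (halfAngle 6 1) +
      1 / 2 * Real.cot (halfAngle 6 2) < 6 ∧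
    8 * ringCoeff 6 1 > Real.cot (halfAngle 6 0) + 2 * 6 - 2 ∧ 10 < (3 * ringCoeff 6 1 - Real.cot (halfAngle 6 0) / 2) * (6 / 2 + ringCoeff 6 1) := by
  have e5 : ringCsc 6 5 = ringCsc 6 1 :=
    ringCsc_sub (n := 6) (s := 1) (by norm_num) (by norm_num)
  have e4 : ringCsc 6 4 = ringCsc 6 2 :=
    ringCsc_sub (n := 6) (s := 2) (by norm_num) (by norm_num)
  have e3 : ringCsc 6 3 = 1 := ringCsc_half (n := 3) (by norm_num)
  have hS := ringCoeff_one_eq (n := 6)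
  simp only [Finset.sum_range_succ, Finset.sum_range_zero, ringCsc_zero, e5, e4, e3] at hS
  obtain ⟨l1, u1⟩ := ringCsc_bounds (n := 6) (s := 1) (lo := 1.99999) (hi := 2.00001)
    (by norm_num) (by norm_num [sinTaylor]) (by norm_num [sinTaylor]) (by norm_num [sinTaylor])
  obtain ⟨l2, u2⟩ := ringCsc_bounds (n := 6) (s := 2) (lo := 1.15470) (hi := 1.15471)
    (by norm_num) (by norm_num [sinTaylor]) (by norm_num [sinTaylor]) (by norm_num [sinTaylor])
  obtain ⟨p0, q0⟩ := cot_bounds (n := 6) (l := 0) (lo := 3.73193) (hi := 3.73206)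
    (by norm_num) rfl rfl (by norm_num) (by norm_num) (by norm_num) (by norm_num [sinTaylor])
    (by norm_num) (by norm_num) (by norm_num [sinTaylor]) (by norm_num [sinTaylor])
  obtain ⟨p1, q1⟩ := cot_bounds (n := 6) (l := 1) (lo := 0.99999) (hi := 1.00001)
    (by norm_num) rfl rfl (by norm_num) (by norm_num) (by norm_num) (by norm_num [sinTaylor])
    (by norm_num) (by norm_num) (by norm_num [sinTaylor]) (by norm_num [sinTaylor])
  obtain ⟨p2, q2⟩ := cot_bounds (n := 6) (l := 2) (lo := 0.26794) (hi := 0.26796)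
    (by norm_num) rfl rfl (by norm_num) (by norm_num) (by norm_num) (by norm_num [sinTaylor])
    (by norm_num) (by norm_num) (by norm_num [sinTaylor]) (by norm_num [sinTaylor])
  refine ⟨by linarith, secondModeForm_nonpos (a := 1.82734) (b := 1.82736) (p := 3.73193) (q := 3.73206) (r := 1.00001) (by norm_num)
    (by linarith) (by linarith) (by norm_num) p0 q0 (by norm_num) q1 (by norm_num), by linarith, by linarith, by linarith, ?_⟩
  have h1 : 3 < 3 * ringCoeff 6 1 - Real.cot (halfAngle 6 0) / 2 := by linarith
  have h2 : 4 < 6 / 2 + ringCoeff 6 1 := by linarith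
  nlinarith

/-- Here the first mode stops contributing; the first inequality holds by less than 0.1. -/
theorem ring_estimates_seven : Real.cot (halfAngle 7 0) + 2 * 7 < 8 * ringCoeff 7 1 ∧
    secondModeForm 7 ≤ 0 ∧ 0 < 12 * ringCoeff 7 1 -
      11 / 2 * Real.cot (halfAngle 7 0) - 3 / 2 * Real.cot (halfAngle 7 1) +
      1 / 2 * Real.cot (halfAngle 7 2) := by
  have e6 : ringCsc 7 6 = ringCsc 7 1 :=
    ringCsc_sub (n := 7) (s := 1) (by norm_num) (by norm_num)
  have e5 : ringCsc 7 5 = ringCsc 7 2 :=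
    ringCsc_sub (n := 7) (s := 2) (by norm_num) (by norm_num)
  have e4 : ringCsc 7 4 = ringCsc 7 3 :=
    ringCsc_sub (n := 7) (s := 3) (by norm_num) (by norm_num)
  have hS := ringCoeff_one_eq (n := 7)
  simp only [Finset.sum_range_succ, Finset.sum_range_zero, ringCsc_zero, e6, e5, e4] at hS
  obtain ⟨l1, u1⟩ := ringCsc_bounds (n := 7) (s := 1) (lo := 2.30476) (hi := 2.30477)
    (by norm_num) (by norm_num [sinTaylor]) (by norm_num [sinTaylor]) (by norm_num [sinTaylor])
  obtain ⟨l2, u2⟩ := ringCsc_bounds (n := 7) (s := 2) (lo := 1.27904) (hi := 1.27905)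
    (by norm_num) (by norm_num [sinTaylor]) (by norm_num [sinTaylor]) (by norm_num [sinTaylor])
  obtain ⟨l3, u3⟩ := ringCsc_bounds (n := 7) (s := 3) (lo := 1.02571) (hi := 1.02576)
    (by norm_num) (by norm_num [sinTaylor]) (by norm_num [sinTaylor]) (by norm_num [sinTaylor])
  obtain ⟨p0, q0⟩ := cot_bounds (n := 7) (l := 0) (lo := 4.38110) (hi := 4.38130)
    (by norm_num) rfl rfl (by norm_num) (by norm_num) (by norm_num) (by norm_num [sinTaylor])
    (by norm_num) (by norm_num) (by norm_num [sinTaylor]) (by norm_num [sinTaylor])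
  obtain ⟨p1, q1⟩ := cot_bounds (n := 7) (l := 1) (lo := 1.25395) (hi := 1.25397)
    (by norm_num) rfl rfl (by norm_num) (by norm_num) (by norm_num) (by norm_num [sinTaylor])
    (by norm_num) (by norm_num) (by norm_num [sinTaylor]) (by norm_num [sinTaylor])
  have p2 := cot_halfAngle_pos (n := 7) (l := 2) (by norm_num)
  exact ⟨by linarith, secondModeForm_nonpos (a := 2.30475) (b := 2.30479) (p := 4.38110) (q := 4.38130) (r := 1.25397) (by norm_num)
    (by linarith) (by linarith) (by norm_num) p0 q0 (by norm_num) q1 (by norm_num), by linarith⟩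

theorem ring_estimates_eight : Real.cot (halfAngle 8 0) + 2 * 8 < 8 * ringCoeff 8 1 ∧
    secondModeForm 8 ≤ 0 ∧ 0 < 12 * ringCoeff 8 1 -
      11 / 2 * Real.cot (halfAngle 8 0) - 3 / 2 * Real.cot (halfAngle 8 1) +
      1 / 2 * Real.cot (halfAngle 8 2) := by
  have e7 : ringCsc 8 7 = ringCsc 8 1 :=
    ringCsc_sub (n := 8) (s := 1) (by norm_num) (by norm_num)
  have e6 : ringCsc 8 6 = ringCsc 8 2 :=
    ringCsc_sub (n := 8) (s := 2) (by norm_num) (by norm_num)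
  have e5 : ringCsc 8 5 = ringCsc 8 3 :=
    ringCsc_sub (n := 8) (s := 3) (by norm_num) (by norm_num)
  have e4 : ringCsc 8 4 = 1 := ringCsc_half (n := 4) (by norm_num)
  have hS := ringCoeff_one_eq (n := 8)
  simp only [Finset.sum_range_succ, Finset.sum_range_zero, ringCsc_zero, e7, e6, e5, e4] at hS
  obtain ⟨l1, u1⟩ := ringCsc_bounds (n := 8) (s := 1) (lo := 2.61312) (hi := 2.61313)
    (by norm_num) (by norm_num [sinTaylor]) (by norm_num [sinTaylor]) (by norm_num [sinTaylor])
  obtain ⟨l2, u2⟩ := ringCsc_bounds (n := 8) (s := 2) (lo := 1.41421) (hi := 1.41422)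
    (by norm_num) (by norm_num [sinTaylor]) (by norm_num [sinTaylor]) (by norm_num [sinTaylor])
  obtain ⟨l3, u3⟩ := ringCsc_bounds (n := 8) (s := 3) (lo := 1.08239) (hi := 1.08241)
    (by norm_num) (by norm_num [sinTaylor]) (by norm_num [sinTaylor]) (by norm_num [sinTaylor])
  obtain ⟨p0, q0⟩ := cot_bounds (n := 8) (l := 0) (lo := 5.02709) (hi := 5.02735)
    (by norm_num) rfl rfl (by norm_num) (by norm_num) (by norm_num) (by norm_num [sinTaylor])
    (by norm_num) (by norm_num) (by norm_num [sinTaylor]) (by norm_num [sinTaylor])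
  obtain ⟨p1, q1⟩ := cot_bounds (n := 8) (l := 1) (lo := 1.49660) (hi := 1.49661)
    (by norm_num) rfl rfl (by norm_num) (by norm_num) (by norm_num) (by norm_num [sinTaylor])
    (by norm_num) (by norm_num) (by norm_num [sinTaylor]) (by norm_num [sinTaylor])
  have p2 := cot_halfAngle_pos (n := 8) (l := 2) (by norm_num)
  exact ⟨by linarith, secondModeForm_nonpos (a := 2.80486) (b := 2.80488) (p := 5.02709) (q := 5.02735) (r := 1.49661) (by norm_num)
    (by linarith) (by linarith) (by norm_num) p0 q0 (by norm_num) q1 (by norm_num), by linarith⟩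

theorem ring_estimates_nine : Real.cot (halfAngle 9 0) + 2 * 9 < 8 * ringCoeff 9 1 ∧
    secondModeForm 9 ≤ 0 ∧ 0 < 12 * ringCoeff 9 1 -
      11 / 2 * Real.cot (halfAngle 9 0) - 3 / 2 * Real.cot (halfAngle 9 1) +
      1 / 2 * Real.cot (halfAngle 9 2) := by
  have e8 : ringCsc 9 8 = ringCsc 9 1 :=
    ringCsc_sub (n := 9) (s := 1) (by norm_num) (by norm_num)
  have e7 : ringCsc 9 7 = ringCsc 9 2 :=
    ringCsc_sub (n := 9) (s := 2) (by norm_num) (by norm_num)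
  have e6 : ringCsc 9 6 = ringCsc 9 3 :=
    ringCsc_sub (n := 9) (s := 3) (by norm_num) (by norm_num)
  have e5 : ringCsc 9 5 = ringCsc 9 4 :=
    ringCsc_sub (n := 9) (s := 4) (by norm_num) (by norm_num)
  have hS := ringCoeff_one_eq (n := 9)
  simp only [Finset.sum_range_succ, Finset.sum_range_zero, ringCsc_zero, e8, e7, e6, e5] at hS
  obtain ⟨l1, u1⟩ := ringCsc_bounds (n := 9) (s := 1) (lo := 2.92380) (hi := 2.92381)
    (by norm_num) (by norm_num [sinTaylor]) (by norm_num [sinTaylor]) (by norm_num [sinTaylor])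
  obtain ⟨l2, u2⟩ := ringCsc_bounds (n := 9) (s := 2) (lo := 1.55572) (hi := 1.55573)
    (by norm_num) (by norm_num [sinTaylor]) (by norm_num [sinTaylor]) (by norm_num [sinTaylor])
  obtain ⟨l3, u3⟩ := ringCsc_bounds (n := 9) (s := 3) (lo := 1.15470) (hi := 1.15471)
    (by norm_num) (by norm_num [sinTaylor]) (by norm_num [sinTaylor]) (by norm_num [sinTaylor])
  obtain ⟨l4, u4⟩ := ringCsc_bounds (n := 9) (s := 4) (lo := 1.01542) (hi := 1.01549)
    (by norm_num) (by norm_num [sinTaylor]) (by norm_num [sinTaylor]) (by norm_num [sinTaylor])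
  obtain ⟨p0, q0⟩ := cot_bounds (n := 9) (l := 0) (lo := 5.67096) (hi := 5.67129)
    (by norm_num) rfl rfl (by norm_num) (by norm_num) (by norm_num) (by norm_num [sinTaylor])
    (by norm_num) (by norm_num) (by norm_num [sinTaylor]) (by norm_num [sinTaylor])
  obtain ⟨p1, q1⟩ := cot_bounds (n := 9) (l := 1) (lo := 1.73204) (hi := 1.73206)
    (by norm_num) rfl rfl (by norm_num) (by norm_num) (by norm_num) (by norm_num [sinTaylor])
    (by norm_num) (by norm_num) (by norm_num [sinTaylor]) (by norm_num [sinTaylor])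
  have p2 := cot_halfAngle_pos (n := 9) (l := 2) (by norm_num)
  exact ⟨by linarith, secondModeForm_nonpos (a := 3.32482) (b := 3.32487) (p := 5.67096) (q := 5.67129) (r := 1.73206) (by norm_num)
    (by linarith) (by linarith) (by norm_num) p0 q0 (by norm_num) q1 (by norm_num), by linarith⟩

/-- Here the second mode starts to contribute. `secondModeForm 10` is below 0.1 while its leading
terms are in the hundreds, so the enclosures must be tight. -/
theorem ring_estimates_ten : Real.cot (halfAngle 10 0) + 2 * 10 < 8 * ringCoeff 10 1 ∧
    0 < secondModeForm 10 := by
  have e9 : ringCsc 10 9 = ringCsc 10 1 :=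
    ringCsc_sub (n := 10) (s := 1) (by norm_num) (by norm_num)
  have e8 : ringCsc 10 8 = ringCsc 10 2 :=
    ringCsc_sub (n := 10) (s := 2) (by norm_num) (by norm_num)
  have e7 : ringCsc 10 7 = ringCsc 10 3 :=
    ringCsc_sub (n := 10) (s := 3) (by norm_num) (by norm_num)
  have e6 : ringCsc 10 6 = ringCsc 10 4 :=
    ringCsc_sub (n := 10) (s := 4) (by norm_num) (by norm_num)
  have e5 : ringCsc 10 5 = 1 := ringCsc_half (n := 5) (by norm_num)
  have hS := ringCoeff_one_eq (n := 10)
  simp only [Finset.sum_range_succ, Finset.sum_range_zero, ringCsc_zero, e9, e8, e7, e6, e5] at hS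
  obtain ⟨l1, u1⟩ := ringCsc_bounds (n := 10) (s := 1) (lo := 3.23606) (hi := 3.23607)
    (by norm_num) (by norm_num [sinTaylor]) (by norm_num [sinTaylor]) (by norm_num [sinTaylor])
  obtain ⟨l2, u2⟩ := ringCsc_bounds (n := 10) (s := 2) (lo := 1.70130) (hi := 1.70131)
    (by norm_num) (by norm_num [sinTaylor]) (by norm_num [sinTaylor]) (by norm_num [sinTaylor])
  obtain ⟨l3, u3⟩ := ringCsc_bounds (n := 10) (s := 3) (lo := 1.23606) (hi := 1.23608)
    (by norm_num) (by norm_num [sinTaylor]) (by norm_num [sinTaylor]) (by norm_num [sinTaylor])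
  obtain ⟨l4, u4⟩ := ringCsc_bounds (n := 10) (s := 4) (lo := 1.05146) (hi := 1.05149)
    (by norm_num) (by norm_num [sinTaylor]) (by norm_num [sinTaylor]) (by norm_num [sinTaylor])
  obtain ⟨p0, q0⟩ := cot_bounds (n := 10) (l := 0) (lo := 6.31336) (hi := 6.31377)
    (by norm_num) rfl rfl (by norm_num) (by norm_num) (by norm_num) (by norm_num [sinTaylor])
    (by norm_num) (by norm_num) (by norm_num [sinTaylor]) (by norm_num [sinTaylor])
  obtain ⟨p1, q1⟩ := cot_bounds (n := 10) (l := 1) (lo := 1.96259) (hi := 1.96262)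
    (by norm_num) rfl rfl (by norm_num) (by norm_num) (by norm_num) (by norm_num [sinTaylor])
    (by norm_num) (by norm_num) (by norm_num [sinTaylor]) (by norm_num [sinTaylor])
  exact ⟨by linarith, secondModeForm_pos (a := 3.86244) (b := 3.86248) (p := 6.31336) (q := 6.31377) (r := 1.96259) (by norm_num)
    (by linarith) (by linarith) (by norm_num) p0 q0 (by norm_num) p1 (by norm_num)⟩

theorem ring_estimates_eleven : Real.cot (halfAngle 11 0) + 2 * 11 < 8 * ringCoeff 11 1 ∧
    0 < secondModeForm 11 := by
  have e10 : ringCsc 11 10 = ringCsc 11 1 :=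
    ringCsc_sub (n := 11) (s := 1) (by norm_num) (by norm_num)
  have e9 : ringCsc 11 9 = ringCsc 11 2 :=
    ringCsc_sub (n := 11) (s := 2) (by norm_num) (by norm_num)
  have e8 : ringCsc 11 8 = ringCsc 11 3 :=
    ringCsc_sub (n := 11) (s := 3) (by norm_num) (by norm_num)
  have e7 : ringCsc 11 7 = ringCsc 11 4 :=
    ringCsc_sub (n := 11) (s := 4) (by norm_num) (by norm_num)
  have e6 : ringCsc 11 6 = ringCsc 11 5 :=
    ringCsc_sub (n := 11) (s := 5) (by norm_num) (by norm_num)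
  have hS := ringCoeff_one_eq (n := 11)
  simp only [Finset.sum_range_succ, Finset.sum_range_zero, ringCsc_zero, e10, e9, e8, e7, e6] at hS
  obtain ⟨l1, u1⟩ := ringCsc_bounds (n := 11) (s := 1) (lo := 3.54946) (hi := 3.54947)
    (by norm_num) (by norm_num [sinTaylor]) (by norm_num [sinTaylor]) (by norm_num [sinTaylor])
  obtain ⟨l2, u2⟩ := ringCsc_bounds (n := 11) (s := 2) (lo := 1.84965) (hi := 1.84966)
    (by norm_num) (by norm_num [sinTaylor]) (by norm_num [sinTaylor]) (by norm_num [sinTaylor])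
  obtain ⟨l3, u3⟩ := ringCsc_bounds (n := 11) (s := 3) (lo := 1.32318) (hi := 1.32320)
    (by norm_num) (by norm_num [sinTaylor]) (by norm_num [sinTaylor]) (by norm_num [sinTaylor])
  obtain ⟨l4, u4⟩ := ringCsc_bounds (n := 11) (s := 4) (lo := 1.09934) (hi := 1.09936)
    (by norm_num) (by norm_num [sinTaylor]) (by norm_num [sinTaylor]) (by norm_num [sinTaylor])
  obtain ⟨l5, u5⟩ := ringCsc_bounds (n := 11) (s := 5) (lo := 1.01028) (hi := 1.01036)
    (by norm_num) (by norm_num [sinTaylor]) (by norm_num [sinTaylor]) (by norm_num [sinTaylor])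
  obtain ⟨p0, q0⟩ := cot_bounds (n := 11) (l := 0) (lo := 6.95468) (hi := 6.95517)
    (by norm_num) rfl rfl (by norm_num) (by norm_num) (by norm_num) (by norm_num [sinTaylor])
    (by norm_num) (by norm_num) (by norm_num [sinTaylor]) (by norm_num [sinTaylor])
  obtain ⟨p1, q1⟩ := cot_bounds (n := 11) (l := 1) (lo := 2.18967) (hi := 2.18970)
    (by norm_num) rfl rfl (by norm_num) (by norm_num) (by norm_num) (by norm_num [sinTaylor])
    (by norm_num) (by norm_num) (by norm_num [sinTaylor]) (by norm_num [sinTaylor])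
  exact ⟨by linarith, secondModeForm_pos (a := 4.41595) (b := 4.41603) (p := 6.95468) (q := 6.95517) (r := 2.18967) (by norm_num)
    (by linarith) (by linarith) (by norm_num) p0 q0 (by norm_num) p1 (by norm_num)⟩

theorem ring_estimates_twelve : Real.cot (halfAngle 12 0) + 2 * 12 < 8 * ringCoeff 12 1 ∧
    0 < secondModeForm 12 := by
  have e11 : ringCsc 12 11 = ringCsc 12 1 :=
    ringCsc_sub (n := 12) (s := 1) (by norm_num) (by norm_num)
  have e10 : ringCsc 12 10 = ringCsc 12 2 :=
    ringCsc_sub (n := 12) (s := 2) (by norm_num) (by norm_num)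
  have e9 : ringCsc 12 9 = ringCsc 12 3 :=
    ringCsc_sub (n := 12) (s := 3) (by norm_num) (by norm_num)
  have e8 : ringCsc 12 8 = ringCsc 12 4 :=
    ringCsc_sub (n := 12) (s := 4) (by norm_num) (by norm_num)
  have e7 : ringCsc 12 7 = ringCsc 12 5 :=
    ringCsc_sub (n := 12) (s := 5) (by norm_num) (by norm_num)
  have e6 : ringCsc 12 6 = 1 := ringCsc_half (n := 6) (by norm_num)
  have hS := ringCoeff_one_eq (n := 12)
  simp only [Finset.sum_range_succ, Finset.sum_range_zero, ringCsc_zero, e11, e10, e9, e8, e7, e6] at hS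
  obtain ⟨l1, u1⟩ := ringCsc_bounds (n := 12) (s := 1) (lo := 3.86370) (hi := 3.86371)
    (by norm_num) (by norm_num [sinTaylor]) (by norm_num [sinTaylor]) (by norm_num [sinTaylor])
  obtain ⟨l2, u2⟩ := ringCsc_bounds (n := 12) (s := 2) (lo := 1.99999) (hi := 2.00001)
    (by norm_num) (by norm_num [sinTaylor]) (by norm_num [sinTaylor]) (by norm_num [sinTaylor])
  obtain ⟨l3, u3⟩ := ringCsc_bounds (n := 12) (s := 3) (lo := 1.41421) (hi := 1.41422)
    (by norm_num) (by norm_num [sinTaylor]) (by norm_num [sinTaylor]) (by norm_num [sinTaylor])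
  obtain ⟨l4, u4⟩ := ringCsc_bounds (n := 12) (s := 4) (lo := 1.15470) (hi := 1.15471)
    (by norm_num) (by norm_num [sinTaylor]) (by norm_num [sinTaylor]) (by norm_num [sinTaylor])
  obtain ⟨l5, u5⟩ := ringCsc_bounds (n := 12) (s := 5) (lo := 1.03527) (hi := 1.03531)
    (by norm_num) (by norm_num [sinTaylor]) (by norm_num [sinTaylor]) (by norm_num [sinTaylor])
  obtain ⟨p0, q0⟩ := cot_bounds (n := 12) (l := 0) (lo := 7.59520) (hi := 7.59577)
    (by norm_num) rfl rfl (by norm_num) (by norm_num) (by norm_num) (by norm_num [sinTaylor])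
    (by norm_num) (by norm_num) (by norm_num [sinTaylor]) (by norm_num [sinTaylor])
  obtain ⟨p1, q1⟩ := cot_bounds (n := 12) (l := 1) (lo := 2.41418) (hi := 2.41422)
    (by norm_num) rfl rfl (by norm_num) (by norm_num) (by norm_num) (by norm_num [sinTaylor])
    (by norm_num) (by norm_num) (by norm_num [sinTaylor]) (by norm_num [sinTaylor])
  exact ⟨by linarith, secondModeForm_pos (a := 4.98393) (b := 4.98398) (p := 7.59520) (q := 7.59577) (r := 2.41418) (by norm_num)
    (by linarith) (by linarith) (by norm_num) p0 q0 (by norm_num) p1 (by norm_num)⟩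

/-! ### Counting the degeneracy values. -/

section
variable {n : ℕ} [NeZero n]

theorem mem_degeneracyValues_iff (hn : 3 ≤ n) {m : ℝ} : m ∈ degeneracyValues n ↔
    0 < m ∧ (firstModeDet n m = 0 ∨ ∃ l, 2 ≤ l ∧ l ≤ n / 2 ∧ m = modeRoot n l) := by
  refine and_congr_right fun hm => ?_
  rw [isDegenerate_iff_modeDet hn hm]
  refine or_congr_right (exists_congr fun l => and_congr_right fun h2 => and_congr_right fun hl => ?_)
  exact modeDet_eq_zero_iff (by omega) (by omega)

theorem encard_modeRoot_image {a : ℕ} (ha : 2 ≤ a) :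
    (modeRoot n '' Set.Icc a (n / 2)).encard = ((n / 2 + 1 - a : ℕ) : ℕ∞) := by
  have hinj : Set.InjOn (modeRoot n) (Set.Icc a (n / 2)) := by
    intro i hi j hj h
    rw [Set.mem_Icc] at hi hj
    rcases lt_trichotomy i j with hij | hij | hij
    · exact absurd h (modeRoot_strictMono (by omega) hij (by omega)).ne
    · exact hij
    · exact absurd h (modeRoot_strictMono (by omega) hij (by omega)).ne'
  rw [hinj.encard_image, ← Finset.coe_Icc, Set.encard_coe_eq_coe_finsetCard, Nat.card_Icc]

/-- By strict monotonicity the positive roots are those from the threshold index `a` on, so only the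
signs near `a` are needed. -/
theorem modeRoot_pos_iff {a l : ℕ} (ha : 2 ≤ a)
    (hneg : ∀ l, 2 ≤ l → l < a → l ≤ n / 2 → modeRoot n l ≤ 0)
    (hpos : a ≤ n / 2 → 0 < modeRoot n a) (h2 : 2 ≤ l) (hl : l ≤ n / 2) :
    0 < modeRoot n l ↔ a ≤ l := by
  constructor
  · intro h
    by_contra hal
    linarith [hneg l h2 (by omega) hl]
  · intro h
    rcases h.eq_or_lt with rfl | h
    · exact hpos hl
    · exact (hpos (by omega)).trans (modeRoot_strictMono (by omega) h (by omega))

/-- No contribution of the first mode. -/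
theorem encard_degeneracyValues_of_lt (hn : 3 ≤ n)
    (hfirst : Real.cot (halfAngle n 0) + 2 * n < 8 * ringCoeff n 1) {a : ℕ} (ha : 2 ≤ a)
    (hneg : ∀ l, 2 ≤ l → l < a → l ≤ n / 2 → modeRoot n l ≤ 0)
    (hpos : a ≤ n / 2 → 0 < modeRoot n a) :
    (degeneracyValues n).encard = ((n / 2 + 1 - a : ℕ) : ℕ∞) := by
  rw [← encard_modeRoot_image (n := n) ha]
  congr 1
  ext m
  rw [mem_degeneracyValues_iff hn]
  constructor
  · rintro ⟨hm, h | ⟨l, h2, hl, rfl⟩⟩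
    · rw [firstModeDet_eq (by omega)] at h
      have h1 := firstModeDet_const_pos (n := n) (by omega)
      have h2 : 0 < 3 / 4 * (8 * ringCoeff n 1 - Real.cot (halfAngle n 0) - 2 * n) * m :=
        mul_pos (by linarith) hm
      linarith
    · exact ⟨l, ⟨(modeRoot_pos_iff ha hneg hpos h2 hl).1 hm, hl⟩, rfl⟩
  · rintro ⟨l, ⟨h1, hl⟩, rfl⟩
    exact ⟨(modeRoot_pos_iff ha hneg hpos (by omega) hl).2 h1,
      Or.inr ⟨l, by omega, hl, rfl⟩⟩

/-- The first mode contributes one degeneracy value. -/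
theorem encard_degeneracyValues_of_gt (hn : 3 ≤ n)
    (hfirst : 8 * ringCoeff n 1 < Real.cot (halfAngle n 0) + 2 * n) {a : ℕ} (ha : 2 ≤ a)
    (hneg : ∀ l, 2 ≤ l → l < a → l ≤ n / 2 → modeRoot n l ≤ 0)
    (hpos : a ≤ n / 2 → 0 < modeRoot n a)
    (hne : ∀ l, a ≤ l → l ≤ n / 2 → firstModeDet n (modeRoot n l) ≠ 0) :
    (degeneracyValues n).encard = ((n / 2 + 1 - a : ℕ) : ℕ∞) + 1 := by
  set k := (3 * ringCoeff n 1 - Real.cot (halfAngle n 0) / 2) * (n / 2 + ringCoeff n 1) with hk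
  have hk0 : 0 < k := firstModeDet_const_pos (by omega)
  set d := 3 / 4 * (Real.cot (halfAngle n 0) + 2 * n - 8 * ringCoeff n 1) with hd
  have hd0 : 0 < d := mul_pos (by norm_num) (by linarith)
  have hroot : ∀ m, firstModeDet n m = 0 ↔ m = k / d := by
    intro m
    have : firstModeDet n m = k - d * m := by
      rw [firstModeDet_eq (by omega), hk, hd]; ring
    rw [this, eq_div_iff hd0.ne', sub_eq_zero, mul_comm, eq_comm]
  rw [← encard_modeRoot_image (n := n) ha, ← Set.encard_insert_of_notMem (a := k / d)]
  · congr 1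
    ext m
    rw [mem_degeneracyValues_iff hn, Set.mem_insert_iff, hroot]
    constructor
    · rintro ⟨hm, rfl | ⟨l, h2, hl, rfl⟩⟩
      · exact Or.inl rfl
      · exact Or.inr ⟨l, ⟨(modeRoot_pos_iff ha hneg hpos h2 hl).1 hm, hl⟩, rfl⟩
    · rintro (rfl | ⟨l, ⟨h1, hl⟩, rfl⟩)
      · exact ⟨div_pos hk0 hd0, Or.inl rfl⟩
      · exact ⟨(modeRoot_pos_iff ha hneg hpos (by omega) hl).2 h1,
          Or.inr ⟨l, by omega, hl, rfl⟩⟩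
  · rintro ⟨l, ⟨h1, hl⟩, h⟩
    exact hne l h1 hl ((hroot _).2 h)

theorem modeRoot_two_nonpos (hn : 4 ≤ n) (h : secondModeForm n ≤ 0) : modeRoot n 2 ≤ 0 := by
  rw [← not_lt, modeRoot_two_pos_iff hn, ← secondModeForm]
  exact not_lt.2 h

theorem encard_degeneracyValues_of_middle (hn : 6 ≤ n)
    (h : Real.cot (halfAngle n 0) + 2 * n < 8 * ringCoeff n 1 ∧ secondModeForm n ≤ 0 ∧
      0 < 12 * ringCoeff n 1 - 11 / 2 * Real.cot (halfAngle n 0) -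
        3 / 2 * Real.cot (halfAngle n 1) + 1 / 2 * Real.cot (halfAngle n 2)) :
    (degeneracyValues n).encard = ((n / 2 - 2 : ℕ) : ℕ∞) := by
  have := encard_degeneracyValues_of_lt (by omega) h.1 (a := 3) (by norm_num)
    (fun l h2 h3 _ => by
      obtain rfl : l = 2 := by omega
      exact modeRoot_two_nonpos (by omega) h.2.1)
    (fun _ => modeRoot_three_pos hn h.2.2)
  rw [this]
  congr 1

theorem encard_degeneracyValues_of_large (hn : 10 ≤ n)
    (h : Real.cot (halfAngle n 0) + 2 * n < 8 * ringCoeff n 1 ∧ 0 < secondModeForm n) :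
    (degeneracyValues n).encard = ((n / 2 - 1 : ℕ) : ℕ∞) := by
  have := encard_degeneracyValues_of_lt (by omega) h.1 (a := 2) le_rfl
    (fun l h2 h3 _ => by omega) (fun _ => (modeRoot_two_pos_iff (by omega)).2 h.2)
  rw [this]
  congr 1

end

theorem encard_degeneracyValues_three : (degeneracyValues 3).encard = 1 := by
  have := encard_degeneracyValues_of_gt (n := 3) le_rfl (by exact_mod_cast ring_estimates_three)
    (a := 2) le_rfl (fun l h2 h3 _ => by omega) (fun h => by omega) (fun l h1 h2 => by omega)
  simpa using this

/-- At l = n/2 the reflection makes the neighbouring coefficients equal; the quotient term vanishes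
and the lower bound used in `modeRoot_three_pos` is exact. -/
theorem modeRoot_six_three : modeRoot 6 3 = (12 * ringCoeff 6 1 -
    11 / 2 * Real.cot (halfAngle 6 0) - 3 / 2 * Real.cot (halfAngle 6 1) +
      1 / 2 * Real.cot (halfAngle 6 2)) / 6 := by
  have h : ringCoeff 6 4 = ringCoeff 6 2 := ringCoeff_sub (n := 6) (l := 2) (by norm_num)
  rw [modeRoot]
  simp only [Nat.reduceAdd, Nat.reduceSub]
  have hz : ((ringCoeff 6 4 - ringCoeff 6 2) / 2) ^ 2 / modeSlope 6 3 = 0 := by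
    rw [h, sub_self]; simp
  rw [hz, ringCoeff_three (n := 6) (by norm_num), ringCoeff_four (n := 6) (by norm_num),
    ringCoeff_two (n := 6) (by norm_num)]
  ring

theorem encard_degeneracyValues_small {n : ℕ} (h4 : 4 ≤ n) (h6 : n ≤ 6) :
    (degeneracyValues n).encard = ((n / 2 - 1 : ℕ) : ℕ∞) := by
  interval_cases n
  · obtain ⟨h1, h2⟩ := ring_estimates_four
    have := encard_degeneracyValues_of_gt (n := 4) (by norm_num) (by exact_mod_cast h1)
      (a := 3) (by norm_num) (fun l h2 h3 _ => by
        obtain rfl : l = 2 := by omega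
        exact modeRoot_two_nonpos (by norm_num) ring_estimates_four.2)
      (fun h => by omega) (fun l h1 h2 => by omega)
    simpa using this
  · obtain ⟨h1, h2⟩ := ring_estimates_five
    have := encard_degeneracyValues_of_gt (n := 5) (by norm_num) (by exact_mod_cast h1)
      (a := 3) (by norm_num) (fun l h2 h3 _ => by
        obtain rfl : l = 2 := by omega
        exact modeRoot_two_nonpos (by norm_num) ring_estimates_five.2)
      (fun h => by omega) (fun l h1 h2 => by omega)
    simpa using this
  · obtain ⟨h1, h2, h3, h4, h5, h6⟩ := ring_estimates_six
    have := encard_degeneracyValues_of_gt (n := 6) (by norm_num) (by exact_mod_cast h1)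
      (a := 3) (by norm_num) (fun l h2 h3 _ => by
        obtain rfl : l = 2 := by omega
        exact modeRoot_two_nonpos (by norm_num) ring_estimates_six.2.1)
      (fun h => modeRoot_three_pos (by norm_num) h3) (fun l ha hb => by
        obtain rfl : l = 3 := by omega
        rw [firstModeDet_eq (by norm_num)]
        have hr : modeRoot 6 3 < 1 := by rw [modeRoot_six_three]; linarith
        have hr0 := modeRoot_three_pos (n := 6) (by norm_num) h3
        push_cast
        -- The constant term exceeds 10, while the slope is above -3/2 and the root lies in (0, 1).
        refine ne_of_gt ?_
        nlinarith)
    rw [this]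
    norm_num

theorem mainTheorem5 :
    (degeneracyValues 3).encard = 1 ∧
    (∀ n : ℕ, 4 ≤ n → n ≤ 6 → (degeneracyValues n).encard = ((n / 2 - 1 : ℕ) : ℕ∞)) ∧
    (∀ n : ℕ, 7 ≤ n → n ≤ 9 → (degeneracyValues n).encard = ((n / 2 - 2 : ℕ) : ℕ∞)) ∧
    (∀ n : ℕ, 10 ≤ n → (degeneracyValues n).encard = ((n / 2 - 1 : ℕ) : ℕ∞)) ∧
    (∀ n : ℕ, 7 ≤ n →
      (degeneracyValues n).encard ≤ (degeneracyValues (n + 1)).encard ∧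
      (degeneracyValues n).encard < (degeneracyValues (n + 2)).encard) := by
  have hmid : ∀ n : ℕ, 7 ≤ n → n ≤ 9 →
      (degeneracyValues n).encard = ((n / 2 - 2 : ℕ) : ℕ∞) := by
    intro n h7 h9
    have : NeZero n := ⟨by omega⟩
    refine encard_degeneracyValues_of_middle (by omega) ?_
    interval_cases n
    · exact_mod_cast ring_estimates_seven
    · exact_mod_cast ring_estimates_eight
    · exact_mod_cast ring_estimates_nine
  have hlarge : ∀ n : ℕ, 10 ≤ n → (degeneracyValues n).encard = ((n / 2 - 1 : ℕ) : ℕ∞) := by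
    intro n h10
    have : NeZero n := ⟨by omega⟩
    refine encard_degeneracyValues_of_large h10 ?_
    rcases le_or_gt 13 n with h | h
    · exact large_ring_estimates h
    · interval_cases n
      · exact_mod_cast ring_estimates_ten
      · exact_mod_cast ring_estimates_eleven
      · exact_mod_cast ring_estimates_twelve
  refine ⟨encard_degeneracyValues_three, fun n h4 h6 => encard_degeneracyValues_small h4 h6,
    hmid, hlarge, fun n h7 => ?_⟩
  have hall : ∀ k, 7 ≤ k → (degeneracyValues k).encard =
      ((if k ≤ 9 then k / 2 - 2 else k / 2 - 1 : ℕ) : ℕ∞) := by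
    intro k hk
    split_ifs with h
    · exact hmid k hk h
    · exact hlarge k (by omega)
  rw [hall n h7, hall (n + 1) (by omega), hall (n + 2) (by omega), Nat.cast_le, Nat.cast_lt]
  constructor <;> split_ifs <;> omega
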